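/- **Conventions.** A partition is a weakly decreasing sequence $\lambda=(\lambda_1\ge\lambda_2\ge\cdots)$ of nonnegative integers with finitely many nonzero terms; the number of nonzero terms is its length, and $|\lambda|=\sum_i\lambda_i$. If $\lambda$ has length at most $N$, its beta numbers are $\beta_i(\lambda,N)=\lambda_i+N-i$ for $1\le i\le N$, and its Schur polynomial in $N$ variables is $$s_\lambda(z_1,\dots,z_N)=\frac{\det\bigl(z_i^{\beta_j(\lambda,N)}\bigr)_{1\le i,j\le N}}{\det\bigl(z_i^{N-j}\bigr)_{1\le i,j\le N}}.$$ A finite set of nonnegative integers $b_1>\dots>b_k$ is called the beta-set of the partition with parts $b_i-k+i$ $(1\le i\le k)$. Let $t\ge 2$, $n\ge 1$ and $0\le m\le t-1$ be integers, let $\omega\in\mathbb{C}$ be a primitive $t$-th root of unity, let $X=(x_1,\dots,x_n)$ and $y$ be indeterminates, and write $\omega^pX=(\omega^px_1,\dots,\omega^px_n)$ and $X^t=(x_1^t,\dots,x_n^t)$. Put $N=tn+m$, let $\lambda$ be a partition of length at most $N$, and let $n_r(\lambda)$ be the number of $i$ with $\beta_i(\lambda,N)\equiv r\pmod t$. * The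 $t$-core $\nu$ of $\lambda$ is the partition with beta-set $\{tj+r : 0\le r\le t-1,\ 0\le j<n_r(\lambda)\}$. * The $t$-quotient of $\lambda$ is $(\lambda^{(0)},\dots,\lambda^{(t-1)})$, where $\lambda^{(r)}$ is the partition with beta-set $\{b\ge 0 : tb+r=\beta_i(\lambda,N)\text{ for some }i\}$. * For distinct $e_1>\dots>e_m$ in $\{0,\dots,t-1\}$, let $e_{m+1}<\dots<e_t$ be the remaining elements of $\{0,\dots,t-1\}$, and for a partition $\mu$ of length at most $N$ let $\sigma_\mu^{(e_1,\dots,e_m)}\in S_N$ be the permutation $\sigma$ for which the sequence $\beta_{\sigma(1)}(\mu,N),\dots,\beta_{\sigma(N)}(\mu,N)$ lists first the beta numbers of $\mu$ congruent to $e_1$ modulo $t$, then those congruent to $e_2$, and so on up to $e_t$, in decreasing order within each residue class. **Theorem.** One has $$s_\lambda(X,\omega X,\dots,\omega^{t-1}X,\,y,\omega y,\dots,\omega^{m-1}y)\ne 0$$ if and only if the $t$-core $\nu$ of $\lambda$ has length at most $m$ and $\nu_1\le t-m$. In that case, with $\beta_i(\nu)=\nu_i+m-i$ for $1\le i\le m$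 (so that $t-1\ge\beta_1(\nu)>\dots>\beta_m(\nu)\ge 0$) and $\beta(\nu)=(\beta_1(\nu),\dots,\beta_m(\nu))$, $$s_\lambda(X,\omega X,\dots,\omega^{t-1}X,y,\omega y,\dots,\omega^{m-1}y)=\operatorname{sgn}\bigl(\sigma_\lambda^{\beta(\nu)}\bigr)\operatorname{sgn}\bigl(\sigma_\nu^{\beta(\nu)}\bigr)\;y^{|\nu|}\;s_\nu(1,\omega,\dots,\omega^{m-1})\prod_{i=1}^m s_{\lambda^{(\beta_i(\nu))}}(X^t,y^t)\prod_{\substack{0\le j\le t-1\\ j\notin\{\beta_1(\nu),\dots,\beta_m(\nu)\}}} s_{\lambda^{(j)}}(X^t).$$ -/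

import Mathlib

namespace SchurFactorization

open MvPolynomial

/-! A partition is a weakly decreasing function `lam : ℕ → ℕ` with finitely many nonzero values;
its parts are `lam 0 ≥ lam 1 ≥ ⋯` (so the parts are numbered from `0`), and it has length at most
`N` when `lam i = 0` for all `i ≥ N`. -/

/-- The beta numbers of `lam` with respect to `N`, for `0 ≤ i < N`: with parts numbered from `0`,
the `i`-th one is `lam i + N - 1 - i`. -/
def beta (N : ℕ) (lam : ℕ → ℕ) (i : ℕ) : ℕ := lam i + (N - 1 - i)

/-- The set of the `N` beta numbers of `lam`. -/
def betaSet (N : ℕ) (lam : ℕ → ℕ) : Finset ℕ := (Finset.range N).image (beta N lam)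

/-- The partition whose beta-set is `S`: if `S` consists of `b 0 > b 1 > ⋯ > b (k - 1)`, then its
`i`-th part is `b i - (k - 1 - i)` for `i < k`, and `0` for `i ≥ k`. -/
def ofBetaSet (S : Finset ℕ) (i : ℕ) : ℕ := (S.sort (· ≥ ·)).getD i 0 - (S.card - 1 - i)

/-- The number of beta numbers of `lam` that are congruent to `r` modulo `t`. -/
def residueCount (t N : ℕ) (lam : ℕ → ℕ) (r : ℕ) : ℕ :=
  ((betaSet N lam).filter (fun b => b % t = r)).card

/-- The `t`-core of a partition `lam` of length at most `N`: the partition whose beta-set consists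
of the numbers `t * j + r` with `r < t` and `0 ≤ j < residueCount t N lam r`. -/
def tCore (t N : ℕ) (lam : ℕ → ℕ) : ℕ → ℕ :=
  ofBetaSet ((Finset.range t).biUnion fun r =>
    (Finset.range (residueCount t N lam r)).image fun j => t * j + r)

/-- The component `lam^(r)` of the `t`-quotient of a partition `lam` of length at most `N`, for
`r < t`: its beta-set consists of the numbers `b` such that `t * b + r` is a beta number of
`lam`. -/
def tQuotient (t N : ℕ) (lam : ℕ → ℕ) (r : ℕ) : ℕ → ℕ :=
  ofBetaSet (((betaSet N lam).filter (fun b => b % t = r)).image (fun b => b / t))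

/-- The residues modulo `t`, listed with `E` first and then the others in increasing order. -/
def residueOrder (t : ℕ) (E : List ℕ) : List ℕ := E ++ (List.range t).filter (fun r => r ∉ E)

/-- The permutation `σ` of the `N` positions that rearranges the beta numbers of `lam` so that
their residues modulo `t` appear in the order of `residueOrder t E`, and the beta numbers with the
same residue appear in decreasing order, i.e. in their original order (`Tuple.sort` is a stable
sort). -/
def sigma (t N : ℕ) (E : List ℕ) (lam : ℕ → ℕ) : Equiv.Perm (Fin N) :=
  Tuple.sort fun j : Fin N => (residueOrder t E).idxOf (beta N lam j % t)

/-- The alternant `det (x_i ^ a_j)` in `N` indeterminates. -/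
noncomputable def alternant (N : ℕ) (a : Fin N → ℕ) : MvPolynomial (Fin N) ℂ :=
  (Matrix.of fun i j : Fin N => (X i : MvPolynomial (Fin N) ℂ) ^ a j).det

theorem alternant_eq_prod (N : ℕ) :
    alternant N (fun j => N - 1 - j) =
      ∏ i : Fin N, ∏ j ∈ Finset.Ioi i, (X i - X j : MvPolynomial (Fin N) ℂ) := by
  have h := Matrix.det_projVandermonde (fun _ : Fin N => (1 : MvPolynomial (Fin N) ℂ)) X
  simp only [one_mul] at h
  rw [← h, alternant]
  congr 1
  ext1 i j
  simp only [Matrix.of_apply, Matrix.projVandermonde_apply, one_pow, one_mul]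
  congr 1
  rw [Fin.val_rev]
  omega

theorem alternant_zero_ne_zero (N : ℕ) : alternant N (fun j => N - 1 - j) ≠ 0 := by
  rw [alternant_eq_prod]
  refine Finset.prod_ne_zero_iff.2 fun i _ => Finset.prod_ne_zero_iff.2 fun j hj => ?_
  rw [sub_ne_zero]
  intro h
  exact (Finset.mem_Ioi.1 hj).ne (X_injective h)

theorem sub_dvd_alternant (N : ℕ) (a : Fin N → ℕ) {i j : Fin N} (hij : i ≠ j) :
    (X i - X j : MvPolynomial (Fin N) ℂ) ∣ alternant N a := by
  rw [← Ideal.mem_span_singleton, ← Ideal.Quotient.eq_zero_iff_mem, alternant, RingHom.map_det]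
  refine Matrix.det_zero_of_row_eq hij ?_
  funext k
  have h : Ideal.Quotient.mk (Ideal.span {(X i - X j : MvPolynomial (Fin N) ℂ)}) (X i) =
      Ideal.Quotient.mk _ (X j) :=
    Ideal.Quotient.eq.2 (Ideal.mem_span_singleton_self _)
  simp [h]

theorem irreducible_X_sub_X (N : ℕ) {i j : Fin N} (hij : i ≠ j) :
    Irreducible (X i - X j : MvPolynomial (Fin N) ℂ) := by
  have h := irreducible_sumSMulX (Finsupp.single i (1 : ℂ) - Finsupp.single j 1)
    ⟨i, by simp [hij]⟩ (fun r hr => ?_)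
  · simpa [sumSMulX, Finsupp.linearCombination_single] using h
  · have := hr i
    simp [hij] at this
    exact isUnit_iff_ne_zero.2 this

theorem isRelPrime_X_sub_X (N : ℕ) {i j k l : Fin N} (hij : i < j) (hkl : k < l)
    (h : (i, j) ≠ (k, l)) :
    IsRelPrime (X i - X j : MvPolynomial (Fin N) ℂ) (X k - X l) := by
  rw [(irreducible_X_sub_X N hij.ne).isRelPrime_iff_not_dvd]
  rintro ⟨q, hq⟩
  have key : ∀ v : Fin N → ℂ, v i = v j → v k = v l := by
    intro v hv
    have := congrArg (eval v) hq
    simp only [map_sub, map_mul, eval_X, hv, sub_self, zero_mul] at this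
    exact sub_eq_zero.1 this
  have h1 := key (Pi.single k 1)
  have h2 := key (Pi.single l 1)
  simp only [Pi.single_apply] at h1 h2
  grind

/-- The denominator of the bialternant formula divides every alternant. -/
theorem alternant_dvd (N : ℕ) (a : Fin N → ℕ) :
    alternant N (fun j => N - 1 - j) ∣ alternant N a := by
  rw [alternant_eq_prod, Finset.prod_sigma']
  refine Finset.prod_dvd_of_isRelPrime ?_ ?_
  · rintro ⟨i, j⟩ hij ⟨k, l⟩ hkl h
    simp only [Finset.coe_sigma, Set.mem_sigma_iff, Finset.coe_univ, Set.mem_univ, true_and,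
      Finset.coe_Ioi, Set.mem_Ioi] at hij hkl
    exact isRelPrime_X_sub_X N hij hkl (by grind)
  · rintro ⟨i, j⟩ hij
    simp only [Finset.mem_sigma, Finset.mem_univ, true_and, Finset.mem_Ioi] at hij
    exact sub_dvd_alternant N a hij.ne

open Classical in
/-- The Schur polynomial `s_lam(x_1, …, x_N)`: for `lam` of length at most `N` it is the quotient
`det (x_i ^ beta_j) / det (x_i ^ (N - j))`, which is a polynomial by `alternant_dvd`; it is `0` if
`lam` has more than `N` parts. -/
noncomputable def schur (N : ℕ) (lam : ℕ → ℕ) : MvPolynomial (Fin N) ℂ :=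
  if ∀ i, N ≤ i → lam i = 0 then (alternant_dvd N fun j => beta N lam j).choose else 0

/-- `schur N lam` is the (unique) polynomial with this property, see `alternant_zero_ne_zero`. -/
theorem alternant_mul_schur (N : ℕ) (lam : ℕ → ℕ) (h : ∀ i, N ≤ i → lam i = 0) :
    alternant N (fun j => N - 1 - j) * schur N lam = alternant N fun j => beta N lam j := by
  rw [schur, if_pos h]
  exact (alternant_dvd N fun j => beta N lam j).choose_spec.symm

/-- The polynomial ring over `ℂ` in the indeterminates `x_1, …, x_n` and `y`. -/
abbrev Poly (n : ℕ) : Type := MvPolynomial (Option (Fin n)) ℂ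

/-- The indeterminate `x_i`. -/
noncomputable def x {n : ℕ} (i : Fin n) : Poly n := X (some i)

/-- The indeterminate `y`. -/
noncomputable def y {n : ℕ} : Poly n := X none

/-- The tuple `(X, ωX, …, ω^(t-1) X, y, ωy, …, ω^(m-1) y)` where `X = (x_1, …, x_n)`: the entry
at position `p * n + i` (with `i < n`, `p < t`) is `ω^p x_i`. -/
noncomputable def twistedPoint (t n m : ℕ) (ω : ℂ) : Fin (t * n + m) → Poly n :=
  Fin.append (fun k : Fin (t * n) => C (ω ^ (k.divNat : ℕ)) * x k.modNat)
    (fun j : Fin m => C (ω ^ (j : ℕ)) * y)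

/-- The tuple `X^t = (x_1^t, …, x_n^t)`. -/
noncomputable def powPoint (t n : ℕ) : Fin n → Poly n := fun i => x i ^ t

/-- The tuple `(X^t, y^t) = (x_1^t, …, x_n^t, y^t)`. -/
noncomputable def powPointY (t n : ℕ) : Fin (n + 1) → Poly n :=
  Fin.append (powPoint t n) (fun _ : Fin 1 => y ^ t)

end SchurFactorization

/-! ### Column operations inside residue classes of exponents. -/

namespace SchurFactorization

open Matrix

/-! Everything rests on the numerator alternant at the twisted point. There the columns whose
exponents are congruent to `r` are determined by their values at `x_1, …, x_n, y`, because
multiplying the point by `ω^p` multiplies such a column entry by `ω^(pr)`. A class with more than `n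
+ 1` columns is therefore dependent, and if a class has fewer than `n` columns, the remaining ones
are too many for the space containing them. In both cases the alternant vanishes
(`det_twisted_eq_zero`). All classes having size `n` or `n + 1` is exactly the box condition on the
core (`residueCount_of_box`, `box_of_residueCount`).

In the box case the alternants of `lam` and of its core have the same class sizes. The columns of
the first are combinations of those of the second through a block triangular matrix: classes of size
`n + 1` interpolate at `X, y`; classes of size `n` interpolate at `X`, and the error in the `m` rows
of `y` is corrected by the larger classes, which is possible because a Vandermonde matrix in powers
of `ω` is invertible. Hence the quotient of the alternants is a product of quotients over classes
(`det_twisted_mul_prod`), and these are the Schur polynomials of the `t`-quotient (`exists_block`).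
The alternant of the core is compared with the denominator by reducing modulo `∏ (z^t - x_s^t)`
(`exists_det_twisted_core`), which produces `y^|ν| s_ν(1, ω, …)`. The sign comes from matching the
positions of the two partitions class by class (`sign_eq_sign_sigma`). -/

/-- The generalized Vandermonde matrix `(z_i ^ a_k)`. -/
def powMatrix {ι κ R : Type*} [Monoid R] (z : ι → R) (a : κ → ℕ) : Matrix ι κ R :=
  Matrix.of fun i k => z i ^ a k

@[simp]
theorem powMatrix_apply {ι κ R : Type*} [Monoid R] (z : ι → R) (a : κ → ℕ) (i : ι) (k : κ) :
    powMatrix z a i k = z i ^ a k := rfl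

theorem map_det_powMatrix {ι R S : Type*} [Fintype ι] [DecidableEq ι] [CommRing R] [CommRing S]
    (f : R →+* S) (z : ι → R) (a : ι → ℕ) :
    f (powMatrix z a).det = (powMatrix (f ∘ z) a).det := by
  rw [RingHom.map_det]
  congr 1
  ext i k
  simp

/-- The tuple `(X, ωX, …, ω^(t-1) X, y, ωy, …, ω^(m-1) y)` over an arbitrary ring. -/
def twisted {R : Type*} [CommRing R] (t m : ℕ) {n : ℕ} (ω : R) (x : Fin n → R) (y : R) :
    Fin (t * n + m) → R :=
  Fin.append (fun k : Fin (t * n) => ω ^ (k.divNat : ℕ) * x k.modNat)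
    (fun j : Fin m => ω ^ (j : ℕ) * y)

/-- The determinant of a matrix that is block triangular for the partition of the indices into the
fibres of `ρ`, where the fibres over `p` come first. -/
theorem det_eq_prod_fiber {R J K : Type*} [Fintype R] [DecidableEq R] [Fintype J] [DecidableEq J]
    [CommRing K] (ρ : J → R) (p : R → Prop) (Q : Matrix J J K)
    (hQ : ∀ i j, Q i j ≠ 0 → ρ i = ρ j ∨ (p (ρ i) ∧ ¬ p (ρ j))) :
    Q.det = ∏ r, (Q.toSquareBlock ρ r).det := by
  classical
  -- Classes satisfying `p` come first; the second coordinate is an arbitrary tie-break, harmless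
  -- because two distinct classes on the same side of `p` do not interact.
  let f : R → ℕ ×ₗ Fin (Fintype.card R) := fun r => toLex (if p r then 0 else 1, Fintype.equivFin R r)
  have hf : Function.Injective f := by
    intro a b h
    have := congrArg (fun z => (ofLex z).2) h
    simpa [f] using this
  let _ : LinearOrder R := LinearOrder.lift' f hf
  refine BlockTriangular.det_fintype ?_
  intro i j hij
  by_contra h
  have hij' : f (ρ j) < f (ρ i) := hij
  rcases hQ i j h with h | ⟨h1, h2⟩
  · rw [h] at hij'
    exact lt_irrefl _ hij'
  · simp only [f, h1, h2, Prod.Lex.toLex_lt_toLex] at hij'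
    simp at hij'

/-- The vectors `q` are the columns of one block triangular `Q` with `M' = M * Q` and `D' r = D r *
Q_rr`, so `det Q` is the product of the determinants of its diagonal blocks. -/
theorem det_mul_prod_fiber {R J K : Type*} [Fintype R] [DecidableEq R] [Fintype J] [DecidableEq J]
    [CommRing K] (ρ : J → R) (p : R → Prop) (M M' : Matrix J J K)
    (D D' : ∀ r, Matrix {k // ρ k = r} {k // ρ k = r} K)
    (h : ∀ j, ∃ q : J → K, (∀ i, q i ≠ 0 → ρ i = ρ j ∨ (p (ρ i) ∧ ¬ p (ρ j))) ∧
      (∀ i, ∑ k, M i k * q k = M' i j) ∧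
      ∀ i, ∑ k : {k // ρ k = ρ j}, D (ρ j) i k * q k = D' (ρ j) i ⟨j, rfl⟩) :
    M'.det * ∏ r, (D r).det = M.det * ∏ r, (D' r).det := by
  choose q h1 h2 h3 using h
  let Q : Matrix J J K := Matrix.of fun i j => q j i
  have e1 : M' = M * Q := by
    ext i j
    simp [Matrix.mul_apply, Q, h2]
  have e2 : ∀ r, D' r = D r * Q.toSquareBlock ρ r := by
    intro r
    ext i ⟨j, rfl⟩
    rw [Matrix.mul_apply, ← h3 j i]
    rfl
  have e3 : Q.det = ∏ r, (Q.toSquareBlock ρ r).det :=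
    det_eq_prod_fiber ρ p Q fun i j hij => h1 j i hij
  simp_rw [e1, e2, det_mul, Finset.prod_mul_distrib, e3]
  ring

/-- Interpolation with the exponents of one class: the square system is invertible, and its solution
is extended by zero, so the full and the restricted sums agree. -/
theorem exists_solution {R J K : Type*} [DecidableEq R] [Fintype J] [DecidableEq J] [Field K]
    (ρ : J → R) (r : R) {d : ℕ} (ι : {k // ρ k = r} ≃ Fin d) (z : Fin d → K) (c : J → ℕ)
    (hD : (powMatrix (z ∘ ι) fun k : {k // ρ k = r} => c k).det ≠ 0) (v : Fin d → K) :
    ∃ q : J → K, (∀ k, q k ≠ 0 → ρ k = r) ∧ (∀ s, ∑ k, z s ^ c k * q k = v s) ∧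
      ∀ s, ∑ k : {k // ρ k = r}, z s ^ c k * q k = v s := by
  set A := powMatrix (z ∘ ι) fun k : {k // ρ k = r} => c k with hA
  let u : {k // ρ k = r} → K := A⁻¹ *ᵥ (v ∘ ι)
  have hu : A *ᵥ u = v ∘ ι := by
    simp only [u]
    rw [mulVec_mulVec, mul_nonsing_inv _ (isUnit_iff_ne_zero.2 hD), one_mulVec]
  let q : J → K := fun k => if h : ρ k = r then u ⟨k, h⟩ else 0
  have hq : ∀ s, ∑ k : {k // ρ k = r}, z s ^ c k * q k = v s := by
    intro s
    have := congrFun hu (ι.symm s)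
    simp only [mulVec, dotProduct, hA, powMatrix_apply, Function.comp_apply,
      Equiv.apply_symm_apply] at this
    rw [← this]
    refine Finset.sum_congr rfl fun k _ => ?_
    simp [q, k.2]
  refine ⟨q, fun k hk => ?_, fun s => ?_, hq⟩
  · by_contra h
    simp [q, h] at hk
  · rw [← hq s, ← Finset.sum_subtype (Finset.univ.filter fun k => ρ k = r) (by simp)
      fun k => z s ^ c k * q k, Finset.sum_filter_of_ne]
    intro k _ hk
    by_contra h
    simp [q, h] at hk

theorem pow_eq_pow_of_mod {R : Type*} [Monoid R] {ζ : R} {t a r : ℕ} (hζ : ζ ^ t = 1)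
    (h : a % t = r) : ζ ^ a = ζ ^ r := by
  rw [← h, ← pow_eq_pow_mod _ hζ]

/-- This is why interpolating at `x_s` suffices for all the points `ω^p x_s`. -/
theorem sum_mul_pow_eq {J K : Type*} [Fintype J] [CommRing K] {t r : ℕ} {ζ : K} (hζ : ζ ^ t = 1)
    (w : K) (c : J → ℕ) (q : J → K) (hq : ∀ k, q k ≠ 0 → c k % t = r) :
    ∑ k, (ζ * w) ^ c k * q k = ζ ^ r * ∑ k, w ^ c k * q k := by
  rw [Finset.mul_sum]
  refine Finset.sum_congr rfl fun k _ => ?_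
  by_cases h : q k = 0
  · simp [h]
  · rw [mul_pow, pow_eq_pow_of_mod hζ (hq k h), mul_assoc]

/-- The column with exponent `a j` is written in terms of the columns with exponents `c k`, using
only the class of `j` and, when that class is small, also the `m` large classes in the range of `e`.
The resulting matrix fits `det_mul_prod_fiber`. -/
theorem det_twisted_mul_prod {K : Type*} [Field K] {t n m : ℕ} {ω : K} (hω : IsPrimitiveRoot ω t)
    (x : Fin n → K) (y : K) (ρ : Fin (t * n + m) → Fin t) (a c : Fin (t * n + m) → ℕ)
    (ha : ∀ k, a k % t = ρ k) (hc : ∀ k, c k % t = ρ k) (e : Fin m → Fin t)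
    (he : Function.Injective e) (w : ∀ r, {k // ρ k = r} → K)
    (hw1 : ∀ r, r ∈ Set.range e → ∃ ι : {k // ρ k = r} ≃ Fin (n + 1),
      w r = Fin.append x (fun _ : Fin 1 => y) ∘ ι)
    (hw2 : ∀ r, r ∉ Set.range e → ∃ ι : {k // ρ k = r} ≃ Fin n, w r = x ∘ ι)
    (hD : ∀ r, (powMatrix (w r) fun k : {k // ρ k = r} => c k).det ≠ 0) :
    (powMatrix (twisted t m ω x y) a).det * ∏ r, (powMatrix (w r) fun k : {k // ρ k = r} => c k).det =
      (powMatrix (twisted t m ω x y) c).det * ∏ r, (powMatrix (w r) fun k : {k // ρ k = r} => a k).det := by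
  have hζ : ∀ p : ℕ, (ω ^ p) ^ t = 1 := fun p => by
    rw [← pow_mul, mul_comm, pow_mul, hω.pow_eq_one, one_pow]
  have key1 : ∀ r, r ∈ Set.range e → ∀ v : Fin n → K, ∀ u : K, ∃ q : Fin (t * n + m) → K,
      (∀ k, q k ≠ 0 → ρ k = r) ∧ (∀ s, ∑ k, x s ^ c k * q k = v s) ∧ ∑ k, y ^ c k * q k = u ∧
      (∀ s, ∑ k : {k // ρ k = r}, x s ^ c k * q k = v s) ∧
      ∑ k : {k // ρ k = r}, y ^ c k * q k = u := by
    intro r hr v u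
    obtain ⟨ι, hι⟩ := hw1 r hr
    have := hD r
    rw [hι] at this
    obtain ⟨q, h1, h2, h3⟩ := exists_solution ρ r ι _ c this (Fin.append v (fun _ : Fin 1 => u))
    refine ⟨q, h1, fun s => ?_, ?_, fun s => ?_, ?_⟩
    · simpa using h2 (Fin.castAdd 1 s)
    · simpa using h2 (Fin.natAdd n 0)
    · simpa using h3 (Fin.castAdd 1 s)
    · simpa using h3 (Fin.natAdd n 0)
  refine det_mul_prod_fiber ρ (· ∈ Set.range e) _ _ (fun r => powMatrix (w r) fun k : {k // ρ k = r} => c k)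
    (fun r => powMatrix (w r) fun k : {k // ρ k = r} => a k) ?_
  intro j
  by_cases hj : ρ j ∈ Set.range e
  · obtain ⟨q, h1, h2, h3, h4, h5⟩ := key1 _ hj (fun s => x s ^ a j) (y ^ a j)
    have hq : ∀ k, q k ≠ 0 → c k % t = ρ j := fun k hk => by rw [hc, h1 k hk]
    refine ⟨q, fun i hi => Or.inl (h1 i hi), fun i => ?_, fun i => ?_⟩
    · refine Fin.addCases (fun i => ?_) (fun i => ?_) i
      · simp only [powMatrix_apply, twisted, Fin.append_left]
        rw [sum_mul_pow_eq (hζ _) _ _ _ hq, h2, mul_pow, pow_eq_pow_of_mod (hζ _) (ha j)]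
      · simp only [powMatrix_apply, twisted, Fin.append_right]
        rw [sum_mul_pow_eq (hζ _) _ _ _ hq, h3, mul_pow, pow_eq_pow_of_mod (hζ _) (ha j)]
    · obtain ⟨ι, hι⟩ := hw1 _ hj
      simp only [powMatrix_apply, hι, Function.comp_apply]
      refine Fin.addCases (fun s => ?_) (fun s => ?_) (ι i)
      · simpa using h4 s
      · simpa using h5
  · obtain ⟨ι, hι⟩ := hw2 _ hj
    have hD' := hD (ρ j)
    rw [hι] at hD'
    obtain ⟨q, h1, h2, h3⟩ := exists_solution ρ (ρ j) ι _ c hD' (fun s => x s ^ a j)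
    have hq : ∀ k, q k ≠ 0 → c k % t = ρ j := fun k hk => by rw [hc, h1 k hk]
    -- Correctors from the large classes: they vanish on all rows from `X` and take the value `1` at
    -- `y`.
    choose g g1 g2 g3 g4 g5 using fun l : Fin m => key1 (e l) ⟨l, rfl⟩ (fun _ => 0) 1
    have hg : ∀ l k, g l k ≠ 0 → c k % t = e l := fun l k hk => by rw [hc, g1 l k hk]
    have hV : ((vandermonde fun l : Fin m => ω ^ (e l : ℕ))ᵀ).det ≠ 0 := by
      rw [det_transpose, det_vandermonde_ne_zero_iff]
      intro l l' h
      exact he (Fin.ext (hω.pow_inj (e l).2 (e l').2 h))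
    set V := (vandermonde fun l : Fin m => ω ^ (e l : ℕ))ᵀ with hVd
    -- The error left in the rows `ω^i y` after interpolating at `X` only.
    let b : Fin m → K := fun i =>
      (ω ^ (i : ℕ)) ^ (ρ j : ℕ) * (y ^ a j - ∑ k, y ^ c k * q k)
    let h := V⁻¹ *ᵥ b
    have hb : ∀ i : Fin m, ∑ l, (ω ^ (i : ℕ)) ^ (e l : ℕ) * h l = b i := by
      intro i
      have : V *ᵥ h = b := by
        simp only [h]
        rw [mulVec_mulVec, mul_nonsing_inv _ (isUnit_iff_ne_zero.2 hV), one_mulVec]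
      rw [← congrFun this i]
      simp only [mulVec, dotProduct, hVd, transpose_apply, vandermonde_apply]
      refine Finset.sum_congr rfl fun l _ => ?_
      rw [← pow_mul, ← pow_mul, mul_comm (i : ℕ)]
    have hsum : ∀ z : K, ∑ k, z ^ c k * (q k + ∑ l, g l k * h l) =
        ∑ k, z ^ c k * q k + ∑ l, (∑ k, z ^ c k * g l k) * h l := by
      intro z
      simp_rw [mul_add, Finset.sum_add_distrib, Finset.mul_sum, Finset.sum_mul, mul_assoc]
      rw [Finset.sum_comm]
    refine ⟨fun k => q k + ∑ l, g l k * h l, fun i hi => ?_, fun i => ?_, fun i => ?_⟩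
    · replace hi : q i + ∑ l, g l i * h l ≠ 0 := hi
      by_cases hqi : q i = 0
      · rw [hqi, zero_add] at hi
        obtain ⟨l, -, hl⟩ := Finset.exists_ne_zero_of_sum_ne_zero hi
        exact Or.inr ⟨⟨l, (g1 l i (left_ne_zero_of_mul hl)).symm⟩, hj⟩
      · exact Or.inl (h1 i hqi)
    · refine Fin.addCases (fun i => ?_) (fun i => ?_) i
      · simp only [powMatrix_apply, twisted, Fin.append_left]
        rw [hsum, sum_mul_pow_eq (hζ _) _ _ _ hq, h2, mul_pow, pow_eq_pow_of_mod (hζ _) (ha j)]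
        simp_rw [sum_mul_pow_eq (hζ _) _ _ _ (hg _), g2]
        simp
      · simp only [powMatrix_apply, twisted, Fin.append_right]
        rw [hsum, sum_mul_pow_eq (hζ _) _ _ _ hq, mul_pow, pow_eq_pow_of_mod (hζ _) (ha j)]
        simp_rw [sum_mul_pow_eq (hζ _) _ _ _ (hg _), g3, mul_one, hb, b]
        ring
    · simp only [powMatrix_apply, hι, Function.comp_apply]
      rw [← h3]
      refine Finset.sum_congr rfl fun k _ => ?_
      rw [Finset.sum_eq_zero, add_zero]
      intro l _
      by_contra hne
      exact hj ⟨l, by rw [← g1 l k (left_ne_zero_of_mul hne), k.2]⟩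

end SchurFactorization

/-! ### Vanishing for unbalanced classes, and the alternant of a core in the box. -/

namespace SchurFactorization

open Matrix

/-- Columns that factor through a space of smaller dimension are dependent: a kernel vector of `B`,
extended by zero along `f`, lies in the kernel of `M`. -/
theorem det_eq_zero_of_factor {I S L K : Type*} [Field K] [Fintype I] [DecidableEq I] [Fintype S]
    [Fintype L] (M : Matrix I I K) (f : S → I) (hf : Function.Injective f)
    (A : Matrix I L K) (B : Matrix L S K) (h : ∀ i s, M i (f s) = ∑ l, A i l * B l s)
    (hcard : Fintype.card L < Fintype.card S) : M.det = 0 := by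
  classical
  obtain ⟨u, hu, hu0⟩ : ∃ u, B *ᵥ u = 0 ∧ u ≠ 0 := by
    have : LinearMap.ker B.mulVecLin ≠ ⊥ := by
      apply LinearMap.ker_ne_bot_of_finrank_lt
      simpa using hcard
    obtain ⟨u, hu, hu0⟩ := (Submodule.ne_bot_iff _).1 this
    exact ⟨u, by simpa using hu, hu0⟩
  rw [← exists_mulVec_eq_zero_iff]
  refine ⟨fun i => ∑ s, if f s = i then u s else 0, fun h0 => hu0 ?_, ?_⟩
  · funext s
    have := congrFun h0 (f s)
    simpa [hf.eq_iff] using this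
  · funext i
    have e : ∀ l, ∑ s, B l s * u s = 0 := fun l => congrFun hu l
    calc ∑ k, M i k * ∑ s, (if f s = k then u s else 0)
        = ∑ s, M i (f s) * u s := by
          simp_rw [Finset.mul_sum, mul_ite, mul_zero]
          rw [Finset.sum_comm]
          simp
      _ = ∑ l, A i l * ∑ s, B l s * u s := by
          simp_rw [h, Finset.sum_mul, Finset.mul_sum, mul_assoc]
          rw [Finset.sum_comm]
      _ = 0 := by simp [e]

/-- Columns of a single class factor through their `n + 1` values at `X, y`. -/
theorem det_twisted_eq_zero_of_large {K : Type*} [Field K] {t n m : ℕ} {ω : K} (hω : ω ^ t = 1)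
    (x : Fin n → K) (y : K) (a : Fin (t * n + m) → ℕ) (r : ℕ)
    (hr : n + 1 < Fintype.card {k // a k % t = r}) :
    (powMatrix (twisted t m ω x y) a).det = 0 := by
  have hζ : ∀ p : ℕ, (ω ^ p) ^ t = 1 := fun p => by
    rw [← pow_mul, mul_comm, pow_mul, hω, one_pow]
  let A : Matrix (Fin (t * n + m)) (Fin (n + 1)) K := Matrix.of (Fin.append
    (fun (k : Fin (t * n)) l => if Fin.castAdd 1 k.modNat = l then (ω ^ (k.divNat : ℕ)) ^ r else 0)
    (fun (j : Fin m) l => if Fin.natAdd n 0 = l then (ω ^ (j : ℕ)) ^ r else 0))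
  let B : Matrix (Fin (n + 1)) {k // a k % t = r} K :=
    Matrix.of fun l k => Fin.append x (fun _ : Fin 1 => y) l ^ a k
  refine det_eq_zero_of_factor _ (Subtype.val : {k // a k % t = r} → _) Subtype.val_injective A B
    ?_ (by simpa using hr)
  intro i ⟨k, hk⟩
  refine Fin.addCases (fun i => ?_) (fun i => ?_) i
  · simp only [powMatrix_apply, twisted, Fin.append_left, A, B, Matrix.of_apply, ite_mul, zero_mul,
      Finset.sum_ite_eq, Finset.mem_univ, if_true]
    rw [mul_pow, pow_eq_pow_of_mod (hζ _) hk]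
  · simp only [powMatrix_apply, twisted, Fin.append_right, A, B, Matrix.of_apply, ite_mul, zero_mul,
      Finset.sum_ite_eq, Finset.mem_univ, if_true]
    rw [mul_pow, pow_eq_pow_of_mod (hζ _) hk]

/-- The columns outside the class `r` factor through dimension `(t - 1) n + m`: one coordinate for
each other residue and each `x_s`, and one for each row from `y`. More than that many columns
remain. -/
theorem det_twisted_eq_zero_of_small {K : Type*} [Field K] {t n m : ℕ} {ω : K} (hω : ω ^ t = 1)
    (x : Fin n → K) (y : K) (a : Fin (t * n + m) → ℕ) (r : Fin t)
    (hr : Fintype.card {k // a k % t = r} < n) :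
    (powMatrix (twisted t m ω x y) a).det = 0 := by
  have hζ : ∀ p : ℕ, (ω ^ p) ^ t = 1 := fun p => by
    rw [← pow_mul, mul_comm, pow_mul, hω, one_pow]
  have ht : 0 < t := r.pos
  let A : Matrix (Fin (t * n + m)) (({r' : Fin t // r' ≠ r} × Fin n) ⊕ Fin m) K :=
    Matrix.of (Fin.append
      (fun (k : Fin (t * n)) => Sum.elim
        (fun l => if k.modNat = l.2 then (ω ^ (k.divNat : ℕ)) ^ (l.1 : ℕ) else 0) 0)
      (fun (j : Fin m) => Sum.elim 0 fun l => if j = l then 1 else 0))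
  let B : Matrix (({r' : Fin t // r' ≠ r} × Fin n) ⊕ Fin m) {k // a k % t ≠ r} K :=
    Matrix.of (Sum.elim (fun l k => if (⟨a k % t, Nat.mod_lt _ ht⟩ : Fin t) = l.1 then x l.2 ^ a k else 0)
      fun j k => (ω ^ (j : ℕ) * y) ^ a k)
  refine det_eq_zero_of_factor _ (Subtype.val : {k // a k % t ≠ r} → _) Subtype.val_injective A B
    ?_ ?_
  · intro i ⟨k, hk⟩
    refine Fin.addCases (fun i => ?_) (fun i => ?_) i
    · simp only [powMatrix_apply, twisted, Fin.append_left, A, B, Matrix.of_apply,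
        Fintype.sum_sum_type, Sum.elim_inl, Sum.elim_inr, Pi.zero_apply, zero_mul,
        Finset.sum_const_zero, add_zero, Fintype.sum_prod_type, ite_mul, mul_ite, mul_zero]
      rw [Finset.sum_eq_single ⟨⟨a k % t, Nat.mod_lt _ ht⟩, fun h => hk (congrArg Fin.val h)⟩]
      · simp only [if_true, Finset.sum_ite_eq, Finset.mem_univ]
        rw [mul_pow, pow_eq_pow_of_mod (hζ _) rfl]
      · rintro ⟨b, hb'⟩ - hb
        refine Finset.sum_eq_zero fun _ _ => if_neg ?_
        rintro rfl
        exact hb rfl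
      · simp
    · simp [twisted, A, B]
  · have h1 := Fintype.card_subtype_compl (fun k => a k % t = r)
    have h2 : Fintype.card {r' : Fin t // r' ≠ r} = t - 1 := by simp
    rw [Fintype.card_fin] at h1
    have h3 : t * n = (t - 1) * n + n := by
      rw [← Nat.succ_mul, Nat.succ_eq_add_one, Nat.sub_add_cancel ht]
    simp only [Fintype.card_sum, Fintype.card_prod, h2, Fintype.card_fin, ne_eq]
    omega

-- Replacing `z^(tn)` by its remainder modulo `∏ (z^t - x_s^t)` uses only powers of `z^t` below `n`;
-- multiplication by `z^b` with `b < t` keeps the degree below `tn`.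
open Polynomial in
theorem exists_pow_eq_sum {K : Type*} [CommRing K] [Nontrivial K] {t n b : ℕ} (hn : 0 < n) (hb : b < t)
    (x : Fin n → K) : ∃ g : Fin (t * n) → K, ∀ z : K, z ^ (t * n + b) =
      ∑ k : Fin (t * n), z ^ (t * n - 1 - k : ℕ) * g k + (∏ s, (z ^ t - x s ^ t)) * z ^ b := by
  let P : K[X] := ∏ s, (X - C (x s ^ t))
  have hPm : P.Monic := monic_prod_of_monic _ _ fun s _ => monic_X_sub_C _
  have hPd : P.natDegree = n := by
    rw [natDegree_prod_of_monic _ _ fun s _ => monic_X_sub_C _]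
    simp only [natDegree_X_sub_C, Finset.sum_const, Finset.card_univ, Fintype.card_fin, smul_eq_mul,
      mul_one]
  have hd : (X ^ n - P).natDegree < n := by
    by_cases h0 : X ^ n - P = 0
    · simpa [h0] using hn
    rw [natDegree_lt_iff_degree_lt h0, ← degree_X_pow (R := K) n]
    refine degree_sub_lt_left ?_ (monic_X_pow n).ne_zero ?_
    · rw [degree_X_pow, degree_eq_natDegree hPm.ne_zero, hPd]
    · rw [(monic_X_pow n).leadingCoeff, hPm.leadingCoeff]
  let F : K[X] := X ^ b * expand K t (X ^ n - P)
  have hF : F.natDegree < t * n := by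
    refine natDegree_mul_le.trans_lt ?_
    rw [natDegree_expand, natDegree_X_pow]
    calc b + (X ^ n - P).natDegree * t ≤ b + (n - 1) * t := by gcongr; omega
      _ < t + (n - 1) * t := by omega
      _ = t * n := by
        obtain ⟨n, rfl⟩ : ∃ n', n = n' + 1 := ⟨n - 1, by omega⟩
        rw [Nat.add_sub_cancel]; ring
  refine ⟨fun k => F.coeff (t * n - 1 - k), fun z => ?_⟩
  have h1 : F.eval z = z ^ (t * n + b) - (∏ s, (z ^ t - x s ^ t)) * z ^ b := by
    simp [F, P, eval_prod]
    ring
  have h2 : F.eval z = ∑ k : Fin (t * n), z ^ (t * n - 1 - k : ℕ) * F.coeff (t * n - 1 - k) := by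
    rw [eval_eq_sum_range' hF, Finset.sum_range, ← Equiv.sum_comp Fin.revPerm]
    refine Finset.sum_congr rfl fun k _ => ?_
    rw [Fin.revPerm_apply, Fin.val_rev, mul_comm, Nat.sub_sub, add_comm 1]
  rw [← h2, h1]
  ring

/-- The exponents `tn + b_i` for `i < m`, followed by `tn - 1, …, 0`. -/
def coreExponent {m : ℕ} (d : ℕ) (b : Fin m → ℕ) (k : Fin (d + m)) : ℕ :=
  if h : (k : ℕ) < m then d + b ⟨k, h⟩ else d + m - 1 - k

/-- The columns `tn + b_i`, reduced by the lower ones, vanish on the rows from `X` and become a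
multiple of `z^(b_i)` on those from `y`. Since `κ` does not depend on `b`, it disappears when two
such determinants are compared. -/
theorem exists_det_twisted_core {K : Type*} [CommRing K] [Nontrivial K] {t n m : ℕ} (hn : 0 < n)
    {ω : K} (hω : ω ^ t = 1) (x : Fin n → K) (y : K) :
    ∃ κ : K, ∀ b : Fin m → ℕ, (∀ i, b i < t) →
      (powMatrix (twisted t m ω x y) (coreExponent (t * n) b)).det =
        κ * (y ^ (∑ i, b i) * (powMatrix (fun i : Fin m => ω ^ (i : ℕ)) b).det) := by
  have hζ : ∀ p : ℕ, (ω ^ p) ^ t = 1 := fun p => by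
    rw [← pow_mul, mul_comm, pow_mul, hω, one_pow]
  -- The `m` special columns stand first while the `m` rows from `y` stand last; the sign of this
  -- mismatch goes into `κ`.
  let e : Fin m ⊕ Fin (t * n) ≃ Fin (t * n + m) := finSumFinEquiv.trans (finCongr (add_comm _ _))
  let f : Fin m ⊕ Fin (t * n) ≃ Fin (t * n + m) := (Equiv.sumComm _ _).trans finSumFinEquiv
  have hsub : ∀ M : Matrix (Fin (t * n + m)) (Fin (t * n + m)) K,
      M.det = Equiv.Perm.sign (e.symm.trans f) * (M.submatrix f e).det := by
    intro M
    have : M.submatrix f e = (M.submatrix (e.symm.trans f) id).submatrix e e := by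
      ext i j
      simp
    rw [this, det_submatrix_equiv_self, det_permute, ← mul_assoc, ← Int.cast_mul, Int.units_coe_mul_self]
    simp
  let pts := twisted t m ω x y
  let P : K := ∏ s, (y ^ t - x s ^ t)
  let D : Matrix (Fin (t * n)) (Fin (t * n)) K :=
    Matrix.of fun i k => pts (Fin.castAdd m i) ^ (t * n - 1 - k : ℕ)
  let B : Matrix (Fin m) (Fin (t * n)) K :=
    Matrix.of fun i k => pts (Fin.natAdd (t * n) i) ^ (t * n - 1 - k : ℕ)
  refine ⟨Equiv.Perm.sign (e.symm.trans f) * (P ^ m * D.det), fun b hb => ?_⟩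
  choose g hg using fun i => exists_pow_eq_sum hn (hb i) x
  let G : Matrix (Fin (t * n)) (Fin m) K := Matrix.of fun k i => g i k
  let W : Matrix (Fin m) (Fin m) K := Matrix.of fun q i => P * pts (Fin.natAdd (t * n) q) ^ b i
  have hM : (powMatrix pts (coreExponent (t * n) b)).submatrix f e =
      fromBlocks W B 0 D * fromBlocks 1 0 G 1 := by
    rw [fromBlocks_multiply]
    have he1 : ∀ i, coreExponent (t * n) b (e (Sum.inl i)) = t * n + b i := by
      intro i
      simp [coreExponent, e]
    have he2 : ∀ k, coreExponent (t * n) b (e (Sum.inr k)) = t * n - 1 - k := by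
      intro k
      simp [coreExponent, e]
      omega
    ext i j
    rcases i with i | i <;> rcases j with j | j
    · simp only [submatrix_apply, powMatrix_apply, he1, hg, fromBlocks_apply₁₁]
      simp only [f, Equiv.trans_apply, Equiv.sumComm_apply, Sum.swap_inl, finSumFinEquiv_apply_right,
        Matrix.mul_one, Matrix.add_apply, Matrix.mul_apply, B, G, W, Matrix.of_apply]
      rw [add_comm]
      have hP : ∏ s, (twisted t m ω x y (Fin.natAdd (t * n) i) ^ t - x s ^ t) = P := by
        simp only [twisted, Fin.append_right, mul_pow, hζ, one_mul, P]
      rw [hP]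
    · simp [he2, f, B]
    · simp only [submatrix_apply, powMatrix_apply, he1, hg, fromBlocks_apply₂₁]
      simp only [f, Equiv.trans_apply, Equiv.sumComm_apply, Sum.swap_inr, finSumFinEquiv_apply_left,
        Matrix.zero_mul, zero_add, Matrix.mul_apply, D, G, Matrix.of_apply]
      rw [Finset.prod_eq_zero (Finset.mem_univ i.modNat), zero_mul, add_zero]
      simp only [pts, twisted, Fin.append_left]
      rw [mul_pow, hζ, one_mul, sub_self]
    · simp [he2, f, D]
  have hW : W.det = P ^ m * (y ^ (∑ i, b i) * (powMatrix (fun i : Fin m => ω ^ (i : ℕ)) b).det) := by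
    have : W = Matrix.of fun q i => (P * y ^ b i) * powMatrix (fun i : Fin m => ω ^ (i : ℕ)) b q i := by
      ext q i
      simp only [W, pts, twisted, Fin.append_right, Matrix.of_apply, powMatrix_apply]
      ring
    rw [this, det_mul_row, Finset.prod_mul_distrib, Finset.prod_pow_eq_pow_sum, Finset.prod_const]
    simp [mul_assoc]
  rw [hsub, hM, det_mul, det_fromBlocks_zero₂₁, det_fromBlocks_zero₁₂, hW]
  simp
  ring

end SchurFactorization

/-! ### Beta-sets, cores and quotients. -/

namespace SchurFactorization

theorem beta_lt_beta {N : ℕ} {lam : ℕ → ℕ} (h : Antitone lam) {i j : ℕ} (hij : i < j) (hj : j < N) :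
    beta N lam j < beta N lam i := by
  have := h hij.le
  simp only [beta]
  omega

theorem strictAnti_beta {N : ℕ} {lam : ℕ → ℕ} (h : Antitone lam) :
    StrictAnti fun i : Fin N => beta N lam i := fun _ j hij => beta_lt_beta h hij j.2

theorem mem_betaSet {N : ℕ} {lam : ℕ → ℕ} {b : ℕ} :
    b ∈ betaSet N lam ↔ ∃ i : Fin N, beta N lam i = b := by
  simp only [betaSet, Finset.mem_image, Finset.mem_range]
  exact ⟨fun ⟨i, h, e⟩ => ⟨⟨i, h⟩, e⟩, fun ⟨i, e⟩ => ⟨i, i.2, e⟩⟩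

theorem betaSet_eq_image (N : ℕ) (lam : ℕ → ℕ) :
    betaSet N lam = Finset.univ.image fun i : Fin N => beta N lam i := by
  ext b
  simp [mem_betaSet]

theorem card_betaSet {N : ℕ} {lam : ℕ → ℕ} (h : Antitone lam) : (betaSet N lam).card = N := by
  rw [betaSet_eq_image, Finset.card_image_of_injective _ (strictAnti_beta h).injective]
  simp

theorem strictAnti_ext {k : ℕ} {f g : Fin k → ℕ} (hf : StrictAnti f) (hg : StrictAnti g)
    (h : Set.range f = Set.range g) : f = g := by
  have := ((hf.comp Fin.rev_strictAnti).range_inj (hg.comp Fin.rev_strictAnti)).1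
    (by simpa only [Fin.rev_surjective.range_comp] using h)
  funext i
  simpa using congrFun this i.rev

theorem sort_getD_lt (S : Finset ℕ) {i j : ℕ} (hij : i < j) (hj : j < S.card) :
    (S.sort (· ≥ ·)).getD j 0 < (S.sort (· ≥ ·)).getD i 0 := by
  have hl : (S.sort (· ≥ ·)).length = S.card := Finset.length_sort _
  rw [List.getD_eq_getElem _ _ (by omega), List.getD_eq_getElem _ _ (by omega)]
  have h1 := List.pairwise_iff_getElem.1 (S.pairwise_sort (· ≥ ·)) i j (by omega) (by omega) hij
  have h2 := List.pairwise_iff_getElem.1 (S.sort_nodup (· ≥ ·)) i j (by omega) (by omega) hij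
  omega

/-- An entry with `d` smaller ones after it is at least `d`, so the truncated subtraction in
`ofBetaSet` is exact. -/
theorem le_sort_getD (S : Finset ℕ) (d : ℕ) : ∀ i, i + d + 1 = S.card →
    d ≤ (S.sort (· ≥ ·)).getD i 0 := by
  induction d with
  | zero => intro i _; exact Nat.zero_le _
  | succ d ih =>
    intro i hi
    have h1 := ih (i + 1) (by omega)
    have h2 := sort_getD_lt S (Nat.lt_succ_self i) (by omega)
    exact Nat.succ_le_of_lt (h1.trans_lt h2)

theorem beta_ofBetaSet (S : Finset ℕ) {i : ℕ} (hi : i < S.card) :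
    beta S.card (ofBetaSet S) i = (S.sort (· ≥ ·)).getD i 0 := by
  have := le_sort_getD S (S.card - 1 - i) i (by omega)
  simp only [beta, ofBetaSet]
  omega

theorem ofBetaSet_eq_zero (S : Finset ℕ) {i : ℕ} (hi : S.card ≤ i) : ofBetaSet S i = 0 := by
  have hl : (S.sort (· ≥ ·)).length = S.card := Finset.length_sort _
  rw [ofBetaSet, List.getD_eq_default _ _ (by omega), Nat.zero_sub]

theorem antitone_ofBetaSet (S : Finset ℕ) : Antitone (ofBetaSet S) := by
  refine antitone_nat_of_succ_le fun i => ?_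
  rcases lt_or_ge (i + 1) S.card with h | h
  · have h1 := sort_getD_lt S (i := i) (Nat.lt_succ_self i) h
    rw [Nat.succ_eq_add_one] at h1
    simp only [ofBetaSet]
    omega
  · rw [ofBetaSet_eq_zero S h]
    exact Nat.zero_le _

theorem betaSet_ofBetaSet (S : Finset ℕ) : betaSet S.card (ofBetaSet S) = S := by
  have hl : (S.sort (· ≥ ·)).length = S.card := Finset.length_sort _
  refine Finset.eq_of_subset_of_card_le (fun b hb => ?_) (card_betaSet (antitone_ofBetaSet S)).ge
  obtain ⟨i, rfl⟩ := mem_betaSet.1 hb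
  rw [beta_ofBetaSet S i.2, List.getD_eq_getElem _ _ (by omega)]
  exact (Finset.mem_sort (· ≥ ·)).1 (List.getElem_mem _)

/-- A strictly decreasing enumeration of `S` lists the beta numbers of `ofBetaSet S`. -/
theorem eq_beta_ofBetaSet {k : ℕ} {S : Finset ℕ} (hS : S.card = k) {f : Fin k → ℕ}
    (hf : StrictAnti f) (h : ∀ b, b ∈ S ↔ ∃ j, f j = b) (j : Fin k) :
    f j = beta k (ofBetaSet S) j := by
  subst hS
  refine congrFun (strictAnti_ext hf (strictAnti_beta (antitone_ofBetaSet S)) ?_) j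
  ext b
  rw [Set.mem_range, Set.mem_range, ← h, ← mem_betaSet, betaSet_ofBetaSet]

theorem card_of_range {k : ℕ} {S : Finset ℕ} {f : Fin k → ℕ}
    (hf : f.Injective) (h : ∀ b, b ∈ S ↔ ∃ j, f j = b) : S.card = k := by
  have : S = Finset.univ.image f := by
    ext b
    simp [h]
  rw [this, Finset.card_image_of_injective _ hf]
  simp

/-- Within a class, division by `t` preserves strict decrease, so the quotients enumerate the
beta-set of `tQuotient`. -/
theorem beta_fiber {t N r k : ℕ} {lam : ℕ → ℕ} (h : Antitone lam) {ι : Fin k → Fin N}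
    (hι : StrictMono ι) (hr : ∀ i : Fin N, beta N lam i % t = r ↔ ∃ j, ι j = i) (j : Fin k) :
    beta N lam (ι j) = t * beta k (tQuotient t N lam r) j + r := by
  have hmod : ∀ j, beta N lam (ι j) % t = r := fun j => (hr _).2 ⟨j, rfl⟩
  have hf : StrictAnti fun j => beta N lam (ι j) / t := by
    intro i j hij
    have h1 : beta N lam (ι j) < beta N lam (ι i) := strictAnti_beta h (hι hij)
    have h2 := Nat.div_add_mod (beta N lam (ι i)) t
    have h3 := Nat.div_add_mod (beta N lam (ι j)) t
    rw [hmod] at h2 h3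
    refine Nat.lt_of_mul_lt_mul_left (a := t) ?_
    simp only
    omega
  have hmem : ∀ b, b ∈ ((betaSet N lam).filter (fun b => b % t = r)).image (fun b => b / t) ↔
      ∃ j, beta N lam (ι j) / t = b := by
    intro b
    simp only [Finset.mem_image, Finset.mem_filter, mem_betaSet]
    constructor
    · rintro ⟨_, ⟨⟨i, rfl⟩, hi⟩, rfl⟩
      obtain ⟨j, rfl⟩ := (hr i).1 hi
      exact ⟨j, rfl⟩
    · rintro ⟨j, rfl⟩
      exact ⟨_, ⟨⟨ι j, rfl⟩, hmod j⟩, rfl⟩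
  have := eq_beta_ofBetaSet (card_of_range hf.injective hmem) hf hmem j
  rw [tQuotient, ← this]
  have h2 := Nat.div_add_mod (beta N lam (ι j)) t
  rw [hmod] at h2
  exact h2.symm

theorem tQuotient_eq_zero {t N r k : ℕ} {lam : ℕ → ℕ} (hk : residueCount t N lam r = k) {i : ℕ}
    (hi : k ≤ i) : tQuotient t N lam r i = 0 :=
  ofBetaSet_eq_zero _ (Finset.card_image_le.trans (hk.le.trans hi))

theorem card_residue_eq {t N : ℕ} {lam : ℕ → ℕ} (h : Antitone lam) (r : ℕ) :
    Fintype.card {i : Fin N // beta N lam i % t = r} = residueCount t N lam r := by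
  rw [residueCount, betaSet_eq_image, Finset.filter_image,
    Finset.card_image_of_injective _ (strictAnti_beta h).injective, Fintype.card_subtype]

/-- The beta-set of the `t`-core. -/
def coreSet (t N : ℕ) (lam : ℕ → ℕ) : Finset ℕ :=
  (Finset.range t).biUnion fun r =>
    (Finset.range (residueCount t N lam r)).image fun j => t * j + r

theorem mem_coreSet {t N : ℕ} {lam : ℕ → ℕ} (ht : 0 < t) {b : ℕ} :
    b ∈ coreSet t N lam ↔ b / t < residueCount t N lam (b % t) := by
  simp only [coreSet, Finset.mem_biUnion, Finset.mem_image, Finset.mem_range]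
  constructor
  · rintro ⟨r, hr, j, hj, rfl⟩
    rwa [Nat.mul_add_mod, Nat.mod_eq_of_lt hr, Nat.mul_add_div ht, Nat.div_eq_of_lt hr, add_zero]
  · exact fun h => ⟨b % t, Nat.mod_lt _ ht, b / t, h, Nat.div_add_mod b t⟩

theorem card_filter_coreSet {t N : ℕ} {lam : ℕ → ℕ} (ht : 0 < t) {r : ℕ} (hr : r < t) :
    ((coreSet t N lam).filter (fun b => b % t = r)).card = residueCount t N lam r := by
  rw [← Finset.card_range (residueCount t N lam r)]
  symm
  refine Finset.card_bij (fun j _ => t * j + r) ?_ ?_ ?_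
  · intro j hj
    rw [Finset.mem_filter, mem_coreSet ht, Nat.mul_add_mod, Nat.mod_eq_of_lt hr, Nat.mul_add_div ht,
      Nat.div_eq_of_lt hr, add_zero]
    exact ⟨Finset.mem_range.1 hj, rfl⟩
  · intro i _ j _ hij
    exact Nat.eq_of_mul_eq_mul_left ht (Nat.add_right_cancel hij)
  · intro b hb
    obtain ⟨h1, h2⟩ := Finset.mem_filter.1 hb
    rw [mem_coreSet ht, h2] at h1
    exact ⟨b / t, Finset.mem_range.2 h1, by rw [← h2]; exact Nat.div_add_mod b t⟩

theorem sum_residueCount {t N : ℕ} {lam : ℕ → ℕ} (ht : 0 < t) (h : Antitone lam) :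
    ∑ r ∈ Finset.range t, residueCount t N lam r = N := by
  conv_rhs => rw [← card_betaSet (N := N) h]
  exact (Finset.card_eq_sum_card_fiberwise (f := fun b => b % t)
    (t := Finset.range t) fun b _ => by simpa using Nat.mod_lt _ ht).symm

theorem card_coreSet {t N : ℕ} {lam : ℕ → ℕ} (ht : 0 < t) (h : Antitone lam) :
    (coreSet t N lam).card = N := by
  rw [Finset.card_eq_sum_card_fiberwise (f := fun b => b % t) (t := Finset.range t)
    fun b _ => by simpa using Nat.mod_lt _ ht]
  refine Eq.trans ?_ (sum_residueCount ht h)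
  exact Finset.sum_congr rfl fun r hr => card_filter_coreSet ht (Finset.mem_range.1 hr)

theorem betaSet_tCore {t N : ℕ} {lam : ℕ → ℕ} (ht : 0 < t) (h : Antitone lam) :
    betaSet N (tCore t N lam) = coreSet t N lam := by
  have := betaSet_ofBetaSet (coreSet t N lam)
  rwa [card_coreSet ht h] at this

theorem antitone_tCore (t N : ℕ) (lam : ℕ → ℕ) : Antitone (tCore t N lam) :=
  antitone_ofBetaSet _

theorem residueCount_tCore {t N : ℕ} {lam : ℕ → ℕ} (ht : 0 < t) (h : Antitone lam) {r : ℕ}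
    (hr : r < t) : residueCount t N (tCore t N lam) r = residueCount t N lam r := by
  rw [residueCount, betaSet_tCore ht h, card_filter_coreSet ht hr]

/-- The core fills every class from the bottom, so its quotient exponents are `k - 1, …, 0`: these
give the Schur denominators. -/
theorem beta_tCore_fiber {t N r k : ℕ} (ht : 0 < t) (hr : r < t) {lam : ℕ → ℕ} (h : Antitone lam)
    {ι : Fin k → Fin N} (hι : StrictMono ι)
    (hιr : ∀ i : Fin N, beta N (tCore t N lam) i % t = r ↔ ∃ j, ι j = i) (j : Fin k) :
    beta N (tCore t N lam) (ι j) = t * (k - 1 - j) + r := by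
  have hk : residueCount t N lam r = k := by
    rw [← residueCount_tCore ht h hr, ← card_residue_eq (antitone_tCore t N lam)]
    refine (Fintype.card_congr (Equiv.ofBijective
      (fun j => (⟨ι j, (hιr _).2 ⟨j, rfl⟩⟩ :
        {i : Fin N // beta N (tCore t N lam) i % t = r})) ⟨?_, ?_⟩)).symm.trans
      (Fintype.card_fin k)
    · intro i j hij
      exact hι.injective (congrArg Subtype.val hij)
    · rintro ⟨i, hi⟩
      obtain ⟨j, rfl⟩ := (hιr i).1 hi
      exact ⟨j, rfl⟩
  rw [beta_fiber (antitone_tCore t N lam) hι hιr, tQuotient, betaSet_tCore ht h]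
  congr 2
  refine (eq_beta_ofBetaSet (f := fun j : Fin k => k - 1 - j) ?_ ?_ ?_ j).symm
  · rw [Finset.card_image_of_injOn, card_filter_coreSet ht hr, hk]
    intro a ha b hb hab
    have ha' := (Finset.mem_filter.1 ha).2
    have hb' := (Finset.mem_filter.1 hb).2
    rw [← Nat.div_add_mod a t, ← Nat.div_add_mod b t, ha', hb']
    exact congrArg (fun z => t * z + r) hab
  · intro i j hij
    have := j.2
    have : (i : ℕ) < j := hij
    show k - 1 - (j : ℕ) < k - 1 - i
    omega
  · intro b
    have h1 : b ∈ ((coreSet t N lam).filter (fun b => b % t = r)).image (fun b => b / t) ↔ b < k := by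
      simp only [Finset.mem_image, Finset.mem_filter, mem_coreSet ht]
      constructor
      · rintro ⟨c, ⟨h1, h2⟩, rfl⟩
        rwa [h2, hk] at h1
      · intro hb
        refine ⟨t * b + r, ?_⟩
        rw [Nat.mul_add_mod, Nat.mod_eq_of_lt hr, Nat.mul_add_div ht, Nat.div_eq_of_lt hr, add_zero, hk]
        exact ⟨⟨hb, rfl⟩, rfl⟩
    rw [h1]
    constructor
    · intro hb
      exact ⟨⟨k - 1 - b, by omega⟩, by simp only; omega⟩
    · rintro ⟨j, rfl⟩
      have := j.2
      omega

/-! ### The box condition in terms of residue counts. -/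

section Condition

variable {t n m : ℕ} {lam : ℕ → ℕ}

/-- A partition in the `m × (t - m)` box has the beta numbers `tn + b_i` for `i < m`, where the
`b_i < t` are the beta numbers with respect to `m`, and `tn - 1, …, 0`. -/
theorem beta_of_box {ν : ℕ → ℕ} (h0 : ∀ i, m ≤ i → ν i = 0) :
    (fun k : Fin (t * n + m) => beta (t * n + m) ν k) =
      coreExponent (t * n) fun i : Fin m => beta m ν i := by
  funext k
  have := k.2
  simp only [coreExponent, beta]
  split_ifs with h
  · omega
  · rw [h0 k (by omega)]
    omega

theorem beta_lt_of_box (hm : m ≤ t - 1) {ν : ℕ → ℕ} (hν : Antitone ν)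
    (h1 : ν 0 ≤ t - m) {i : ℕ} (hi : i < m) : beta m ν i < t := by
  have := hν (Nat.zero_le i)
  simp only [beta]
  omega

theorem residueCount_of_box (ht : 0 < t) (hm : m ≤ t - 1)
    (h : Antitone lam) (h0 : ∀ i, m ≤ i → tCore t (t * n + m) lam i = 0)
    (h1 : tCore t (t * n + m) lam 0 ≤ t - m) {r : ℕ} (hr : r < t) :
    residueCount t (t * n + m) lam r =
      if ∃ i, i < m ∧ beta m (tCore t (t * n + m) lam) i = r then n + 1 else n := by
  set ν := tCore t (t * n + m) lam with hν
  have hmem : ∀ j, j < residueCount t (t * n + m) lam r ↔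
      ∃ k : Fin (t * n + m), beta (t * n + m) ν k = t * j + r := by
    intro j
    rw [← mem_betaSet, betaSet_tCore ht h, mem_coreSet ht, Nat.mul_add_mod, Nat.mod_eq_of_lt hr,
      Nat.mul_add_div ht, Nat.div_eq_of_lt hr, add_zero]
  have hb := fun k => congrFun (beta_of_box (t := t) (n := n) h0) k
  have hge : n ≤ residueCount t (t * n + m) lam r := by
    by_contra hlt
    refine hlt ?_
    -- Were the count below `n`, then `t * count + r < tn` would be a beta number of the core, and
    -- `hmem` would give `count < count`.
    have : ¬ residueCount t (t * n + m) lam r < residueCount t (t * n + m) lam r := lt_irrefl _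
    refine absurd ((hmem _).2 ?_) this
    have hlt' : t * residueCount t (t * n + m) lam r + r < t * n := by
      calc _ < t * residueCount t (t * n + m) lam r + t := by omega
        _ = t * (residueCount t (t * n + m) lam r + 1) := by ring
        _ ≤ t * n := Nat.mul_le_mul_left _ (by omega)
    refine ⟨⟨t * n + m - 1 - (t * residueCount t (t * n + m) lam r + r), by omega⟩, ?_⟩
    rw [hb, coreExponent, dif_neg (by simp only; omega)]
    simp only
    omega
  have hiff : n < residueCount t (t * n + m) lam r ↔ ∃ i, i < m ∧ beta m ν i = r := by
    rw [hmem]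
    constructor
    · rintro ⟨k, hk⟩
      rw [hb, coreExponent] at hk
      split_ifs at hk with hkm
      · exact ⟨k, hkm, Nat.add_left_cancel hk⟩
      · omega
    · rintro ⟨i, hi, rfl⟩
      refine ⟨⟨i, by omega⟩, ?_⟩
      rw [hb, coreExponent, dif_pos hi]
  have hle : ¬ n + 1 < residueCount t (t * n + m) lam r := by
    rw [hmem]
    rintro ⟨k, hk⟩
    rw [hb, coreExponent, Nat.mul_succ] at hk
    split_ifs at hk with hkm
    · have : beta m ν k < t := beta_lt_of_box hm (antitone_tCore t (t * n + m) lam) h1 hkm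
      simp only at hk
      omega
    · have := k.2
      omega
  split_ifs with hc
  · have := hiff.2 hc
    omega
  · have := mt hiff.1 hc
    omega

/-- The lower bound puts all of `0, …, tn - 1` into the core's beta-set, leaving room for only `m`
larger elements. The upper bound keeps the largest one below `t (n + 1)`. -/
theorem box_of_residueCount (ht : 0 < t) (hn : 0 < n) (h : Antitone lam)
    (hlo : ∀ r, r < t → n ≤ residueCount t (t * n + m) lam r)
    (hhi : ∀ r, r < t → residueCount t (t * n + m) lam r ≤ n + 1) :
    (∀ i, m ≤ i → tCore t (t * n + m) lam i = 0) ∧ tCore t (t * n + m) lam 0 ≤ t - m := by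
  set ν := tCore t (t * n + m) lam with hν
  have hanti : Antitone ν := antitone_tCore t (t * n + m) lam
  have hmem : ∀ b, (∃ k : Fin (t * n + m), beta (t * n + m) ν k = b) ↔
      b / t < residueCount t (t * n + m) lam (b % t) := by
    intro b
    rw [← mem_betaSet, betaSet_tCore ht h, mem_coreSet ht]
  have hlow : ∀ b, b < t * n → ∃ k : Fin (t * n + m), beta (t * n + m) ν k = b := by
    intro b hb
    rw [hmem]
    exact (Nat.div_lt_of_lt_mul hb).trans_le (hlo _ (Nat.mod_lt _ ht))
  have hpos : 0 < t * n := Nat.mul_pos ht hn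
  -- All numbers below this beta number occur at later positions, of which there are only `N - 1 -
  -- i`. Equality with `tn` is allowed because only smaller numbers are needed.
  have hzero : ∀ i : Fin (t * n + m), beta (t * n + m) ν i ≤ t * n → ν i = 0 := by
    intro i hi
    have hsub : Finset.range (beta (t * n + m) ν i) ⊆
        (Finset.Ioi i).image fun k : Fin (t * n + m) => beta (t * n + m) ν k := by
      intro b hb
      rw [Finset.mem_range] at hb
      obtain ⟨k, rfl⟩ := hlow b (by omega)
      exact Finset.mem_image_of_mem _ (Finset.mem_Ioi.2 ((strictAnti_beta hanti).lt_iff_gt.1 hb))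
    have := (Finset.card_le_card hsub).trans Finset.card_image_le
    rw [Finset.card_range, Fin.card_Ioi] at this
    simp only [beta] at this
    omega
  constructor
  · intro i hi
    rcases lt_or_ge i (t * n + m) with hN | hN
    · refine hzero ⟨i, hN⟩ ?_
      by_contra hlt
      push Not at hlt
      -- Otherwise the positions up to `i` give `i + 1 > m` beta numbers above `tn`, besides the
      -- `tn` small ones: too many.
      have hdisj : Disjoint (Finset.range (t * n))
          ((Finset.Iic (⟨i, hN⟩ : Fin (t * n + m))).image fun k : Fin (t * n + m) => beta (t * n + m) ν k) := by
        rw [Finset.disjoint_left]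
        intro b hb hb'
        rw [Finset.mem_range] at hb
        obtain ⟨k, hk, rfl⟩ := Finset.mem_image.1 hb'
        have h1 : beta (t * n + m) ν i ≤ beta (t * n + m) ν k :=
          (strictAnti_beta (N := t * n + m) hanti).antitone (Finset.mem_Iic.1 hk)
        have h2 : t * n < beta (t * n + m) ν i := hlt
        omega
      have hsub : Finset.range (t * n) ∪
          ((Finset.Iic (⟨i, hN⟩ : Fin (t * n + m))).image fun k : Fin (t * n + m) => beta (t * n + m) ν k) ⊆
          betaSet (t * n + m) ν := by
        refine Finset.union_subset (fun b hb => ?_) (fun b hb => ?_)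
        · exact mem_betaSet.2 (hlow b (Finset.mem_range.1 hb))
        · obtain ⟨k, -, rfl⟩ := Finset.mem_image.1 hb
          exact mem_betaSet.2 ⟨k, rfl⟩
      have := Finset.card_le_card hsub
      rw [Finset.card_union_of_disjoint hdisj, card_betaSet hanti,
        Finset.card_image_of_injective _ (strictAnti_beta hanti).injective, Finset.card_range,
        Fin.card_Iic] at this
      simp only at this
      omega
    · exact ofBetaSet_eq_zero _ ((card_coreSet ht h).le.trans hN)
  · have h1 := (hmem _).1 ⟨⟨0, by omega⟩, rfl⟩
    have h2 := (Nat.div_lt_iff_lt_mul ht).1 (h1.trans_le (hhi _ (Nat.mod_lt _ ht)))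
    simp only [beta] at h2
    rw [add_mul, mul_comm n, one_mul] at h2
    omega

end Condition

/-! ### Matching residue classes and comparing signs. -/

theorem exists_perm_of_card_fiber {α γ : Type*} [LinearOrder α] [Fintype α] [DecidableEq γ]
    (f g : α → γ) (h : ∀ r, Fintype.card {i // f i = r} = Fintype.card {i // g i = r}) :
    ∃ π : Equiv.Perm α, (∀ k, g (π k) = f k) ∧ ∀ i j, i < j → f i = f j → π i < π j := by
  let e : ∀ r, {i // f i = r} ≃o {i // g i = r} := fun r =>
    (Fintype.orderIsoFinOfCardEq _ (h r)).symm.trans (Fintype.orderIsoFinOfCardEq _ rfl)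
  refine ⟨Equiv.ofFiberEquiv fun r => (e r).toEquiv, Equiv.ofFiberEquiv_map _, fun i j hij hf => ?_⟩
  have hval : ∀ i r, ∀ hi : f i = r,
      Equiv.ofFiberEquiv (fun r => (e r).toEquiv) i = (e r ⟨i, hi⟩ : α) := by
    rintro i _ rfl
    rfl
  rw [hval i _ hf, hval j _ rfl]
  exact (e (f j)).strictMono (a := ⟨i, hf⟩) (b := ⟨j, rfl⟩) hij

/-- A stable sort is characterized by sorted values and increasing positions among ties; `π`
transports both. -/
theorem sort_eq_of_perm {N : ℕ} {f g : Fin N → ℕ} (π : Equiv.Perm (Fin N))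
    (h1 : ∀ k, g (π k) = f k) (h2 : ∀ i j, i < j → f i = f j → π i < π j) :
    π * Tuple.sort f = Tuple.sort g := by
  rw [Tuple.eq_sort_iff]
  obtain ⟨h3, h4⟩ := Tuple.eq_sort_iff.1 (rfl : Tuple.sort f = Tuple.sort f)
  constructor
  · have : g ∘ (π * Tuple.sort f) = f ∘ Tuple.sort f := by
      funext k
      simp [h1]
    rwa [this]
  · intro i j hij hg
    simp only [Equiv.Perm.coe_mul, Function.comp_apply, h1] at hg ⊢
    exact h2 _ _ (h4 i j hij hg) hg

/-- Here `π σ_ν = σ_lam`, whatever `E` is: every residue occurs in `residueOrder t E`, so equal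
indices mean equal residues. -/
theorem sign_eq_sign_sigma {t N : ℕ} (ht : 0 < t) {E : List ℕ} {lam ν : ℕ → ℕ}
    (π : Equiv.Perm (Fin N)) (h1 : ∀ k, beta N lam (π k) % t = beta N ν k % t)
    (h2 : ∀ i j : Fin N, i < j → beta N ν i % t = beta N ν j % t → π i < π j) :
    Equiv.Perm.sign π = Equiv.Perm.sign (sigma t N E lam) * Equiv.Perm.sign (sigma t N E ν) := by
  have hmem : ∀ b, b % t ∈ residueOrder t E := by
    intro b
    by_cases hb : b % t ∈ E
    · exact List.mem_append_left _ hb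
    · refine List.mem_append_right _ (List.mem_filter.2 ⟨List.mem_range.2 (Nat.mod_lt _ ht), ?_⟩)
      simpa using hb
  have := sort_eq_of_perm (f := fun j : Fin N => (residueOrder t E).idxOf (beta N ν j % t))
    (g := fun j : Fin N => (residueOrder t E).idxOf (beta N lam j % t)) π (fun k => by simp only [h1])
    (fun i j hij hf => h2 i j hij ((List.idxOf_inj (hmem _)).1 hf))
  rw [sigma, ← this, Equiv.Perm.sign_mul, mul_assoc, sigma, Int.units_mul_self, mul_one]

end SchurFactorization

/-! ### From alternants to Schur polynomials at the twisted point. -/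

namespace SchurFactorization

open Matrix MvPolynomial

/-- With distinct exponents, the diagonal monomial arises from the identity permutation alone. -/
theorem alternant_ne_zero {k : ℕ} {a : Fin k → ℕ} (ha : a.Injective) : alternant k a ≠ 0 := by
  have hprod : ∀ σ : Equiv.Perm (Fin k), ∏ i, (X (σ i) : MvPolynomial (Fin k) ℂ) ^ a i =
      monomial (∑ i, Finsupp.single (σ i) (a i)) 1 := by
    intro σ
    rw [monomial_sum_one]
    exact Finset.prod_congr rfl fun i _ => X_pow_eq_monomial
  have hone : ∀ σ : Equiv.Perm (Fin k), (∑ i, Finsupp.single (σ i) (a i)) =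
      (∑ i, Finsupp.single i (a i)) → σ = 1 := by
    intro σ h
    ext1 j
    have h1 := DFunLike.congr_fun h (σ j)
    simp only [Finsupp.coe_finsetSum, Finset.sum_apply, Finsupp.single_apply,
      σ.injective.eq_iff, Finset.sum_ite_eq', Finset.mem_univ, if_true] at h1
    exact (ha h1).symm
  intro h
  have h2 := congrArg (coeff (∑ i, Finsupp.single i (a i))) h
  rw [alternant, det_apply, coeff_sum, Finset.sum_eq_single 1] at h2
  · have := hprod 1
    simp only [Equiv.Perm.coe_one, id] at this
    simp [this] at h2
  · intro σ _ hσ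
    simp only [Matrix.of_apply, hprod]
    rw [Units.smul_def, coeff_smul, coeff_monomial, if_neg fun h => hσ (hone σ h), smul_zero]
  · simp

theorem aeval_alternant {R : Type*} [CommRing R] [Algebra ℂ R] {k : ℕ} (z : Fin k → R)
    (a : Fin k → ℕ) : aeval z (alternant k a) = (powMatrix z a).det := by
  have h : alternant k a = (powMatrix X a).det := rfl
  have h2 := map_det_powMatrix (aeval (R := ℂ) z).toRingHom X a
  rw [h]
  refine h2.trans ?_
  congr 2
  funext i
  simp

theorem det_powMatrix_mul_schur {R : Type*} [CommRing R] [Algebra ℂ R] {k : ℕ} (z : Fin k → R)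
    {μ : ℕ → ℕ} (hμ : ∀ i, k ≤ i → μ i = 0) :
    (powMatrix z fun j : Fin k => k - 1 - j).det * aeval z (schur k μ) =
      (powMatrix z fun j : Fin k => beta k μ j).det := by
  rw [← aeval_alternant, ← aeval_alternant, ← map_mul, alternant_mul_schur k μ hμ]

theorem det_powMatrix_X_ne_zero {σ : Type*} {k : ℕ} {f : Fin k → σ} (hf : f.Injective)
    {a : Fin k → ℕ} (ha : a.Injective) :
    (powMatrix (fun i => (X (f i) : MvPolynomial σ ℂ)) a).det ≠ 0 := by
  have : aeval (fun i => (X (f i) : MvPolynomial σ ℂ)) = rename f := algHom_ext fun i => by simp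
  rw [← aeval_alternant, this]
  exact (map_ne_zero_iff _ (rename_injective f hf)).2 (alternant_ne_zero ha)

theorem det_powMatrix_mul_add {R : Type*} [CommRing R] {k : ℕ} (z : Fin k → R) (t r : ℕ)
    (b : Fin k → ℕ) : (powMatrix z fun j => t * b j + r).det =
      (∏ i, z i ^ r) * (powMatrix (fun i => z i ^ t) b).det := by
  rw [← det_mul_column]
  congr 1
  ext i j
  simp only [powMatrix_apply, Matrix.of_apply]
  ring

theorem det_powMatrix_comp_equiv {κ R : Type*} [Fintype κ] [DecidableEq κ] [CommRing R] {k : ℕ}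
    (z : Fin k → R) (ι : Fin k ≃ κ) (a : κ → ℕ) :
    (powMatrix (z ∘ ι.symm) a).det = (powMatrix z (a ∘ ι)).det := by
  rw [← det_submatrix_equiv_self ι.symm (powMatrix z (a ∘ ι))]
  congr 1
  ext i j
  simp

theorem map_twisted {R S : Type*} [CommRing R] [CommRing S] (φ : R →+* S) (t m : ℕ) {n : ℕ} (ω : R)
    (x : Fin n → R) (y : R) : φ ∘ twisted t m ω x y = twisted t m (φ ω) (φ ∘ x) (φ y) := by
  funext i
  refine Fin.addCases (fun i => ?_) (fun i => ?_) i <;> simp [twisted]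

section Domain

variable {R : Type*} [CommRing R] [IsDomain R] {t n m : ℕ} {ω : R}

theorem det_twisted_eq_zero (hω : ω ^ t = 1) (x : Fin n → R) (y : R) (a : Fin (t * n + m) → ℕ)
    (r : Fin t) (hr : Fintype.card {k // a k % t = r} < n ∨ n + 1 < Fintype.card {k // a k % t = r}) :
    (powMatrix (twisted t m ω x y) a).det = 0 := by
  apply IsFractionRing.injective R (FractionRing R)
  rw [map_zero, map_det_powMatrix, map_twisted]
  have hω' : (algebraMap R (FractionRing R) ω) ^ t = 1 := by rw [← map_pow, hω, map_one]
  rcases hr with hr | hr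
  · exact det_twisted_eq_zero_of_small hω' _ _ a r hr
  · exact det_twisted_eq_zero_of_large hω' _ _ a r hr

/-- Transfer of `det_twisted_mul_prod` through the fraction field; the nonzero blocks are then
cancelled. -/
theorem det_twisted_eq_mul_prod (hω : IsPrimitiveRoot ω t)
    (x : Fin n → R) (y : R) (ρ : Fin (t * n + m) → Fin t) (a c : Fin (t * n + m) → ℕ)
    (ha : ∀ k, a k % t = ρ k) (hc : ∀ k, c k % t = ρ k) (e : Fin m → Fin t)
    (he : Function.Injective e) (w : ∀ r, {k // ρ k = r} → R)
    (hw1 : ∀ r, r ∈ Set.range e → ∃ ι : {k // ρ k = r} ≃ Fin (n + 1),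
      w r = Fin.append x (fun _ : Fin 1 => y) ∘ ι)
    (hw2 : ∀ r, r ∉ Set.range e → ∃ ι : {k // ρ k = r} ≃ Fin n, w r = x ∘ ι)
    (hD : ∀ r, (powMatrix (w r) fun k : {k // ρ k = r} => c k).det ≠ 0) (F : Fin t → R)
    (hF : ∀ r, (powMatrix (w r) fun k : {k // ρ k = r} => a k).det =
      F r * (powMatrix (w r) fun k : {k // ρ k = r} => c k).det) :
    (powMatrix (twisted t m ω x y) a).det = (powMatrix (twisted t m ω x y) c).det * ∏ r, F r := by
  set φ := algebraMap R (FractionRing R)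
  have hφ : Function.Injective φ := IsFractionRing.injective R (FractionRing R)
  have key := det_twisted_mul_prod (hω.map_of_injective hφ) (φ ∘ x) (φ y) ρ a c ha hc e he
    (fun r => φ ∘ w r) ?_ ?_ ?_
  · simp_rw [← map_twisted, ← map_det_powMatrix, hF, map_mul, Finset.prod_mul_distrib, ← map_prod,
      ← map_mul] at key
    have key' := hφ key
    rw [← mul_assoc] at key'
    exact mul_right_cancel₀ (Finset.prod_ne_zero_iff.2 fun r _ => hD r) key'
  · intro r hr
    obtain ⟨ι, hι⟩ := hw1 r hr
    refine ⟨ι, ?_⟩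
    simp only [hι]
    funext k
    simp only [Function.comp_apply]
    refine Fin.addCases (fun i => ?_) (fun i => ?_) (ι k) <;> simp
  · intro r hr
    obtain ⟨ι, hι⟩ := hw2 r hr
    exact ⟨ι, by simp only [hι]; rfl⟩
  · intro r
    rw [← map_det_powMatrix]
    exact (map_ne_zero_iff φ hφ).2 (hD r)

end Domain

theorem twistedPoint_eq (t n m : ℕ) (ω : ℂ) :
    twistedPoint t n m ω = twisted t m (C ω) x y := by
  simp only [twistedPoint, twisted, map_pow]

theorem C_mul_X_injective {σ : Type*} {a b : ℂ} {s s' : σ} (ha : a ≠ 0)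
    (h : (C a * X s : MvPolynomial σ ℂ) = C b * X s') : s = s' ∧ a = b := by
  classical
  have h1 := congrArg (coeff (Finsupp.single s 1)) h
  simp only [coeff_C_mul, coeff_X, if_true, mul_one] at h1
  by_cases hs : s' = s
  · subst hs
    exact ⟨rfl, by simpa using h1⟩
  · rw [if_neg fun h => hs (Finsupp.single_left_injective one_ne_zero h)] at h1
    simp [ha] at h1

theorem twistedPoint_injective {t n m : ℕ} (hm : m ≤ t) {ω : ℂ} (hω : IsPrimitiveRoot ω t)
    (ht : 0 < t) : Function.Injective (twistedPoint t n m ω) := by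
  have hω0 : ∀ p : ℕ, ω ^ p ≠ 0 := fun p => pow_ne_zero _ (hω.ne_zero ht.ne')
  intro i j
  refine Fin.addCases (fun i => ?_) (fun i => ?_) i <;>
  refine Fin.addCases (fun j => ?_) (fun j => ?_) j <;>
  simp only [twistedPoint, Fin.append_left, Fin.append_right, x, y] <;> intro h <;>
  obtain ⟨h1, h2⟩ := C_mul_X_injective (hω0 _) h
  · have h3 : i.divNat = j.divNat := Fin.ext (hω.pow_inj (Fin.is_lt _) (Fin.is_lt _) h2)
    have h4 : i.modNat = j.modNat := Option.some_injective _ h1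
    congr 1
    exact finProdFinEquiv.symm.injective (Prod.ext h3 h4)
  · exact absurd h1 (by simp)
  · exact absurd h1 (by simp)
  · congr 1
    exact Fin.ext (hω.pow_inj (i.2.trans_le hm) (j.2.trans_le hm) h2)

theorem det_twistedPoint_ne_zero {t n m : ℕ} (hm : m ≤ t) {ω : ℂ} (hω : IsPrimitiveRoot ω t)
    (ht : 0 < t) :
    (powMatrix (twistedPoint t n m ω) fun j : Fin (t * n + m) => t * n + m - 1 - j).det ≠ 0 := by
  rw [← aeval_alternant, alternant_eq_prod, map_prod]
  refine Finset.prod_ne_zero_iff.2 fun i _ => ?_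
  rw [map_prod]
  refine Finset.prod_ne_zero_iff.2 fun j hj => ?_
  rw [map_sub, aeval_X, aeval_X, sub_ne_zero]
  exact fun h => (Finset.mem_Ioi.1 hj).ne (twistedPoint_injective hm hω ht h)

/-- The transpose is the Vandermonde matrix of the `ω^(b_l)`, distinct since the `b_l < t` are. -/
theorem det_root_ne_zero {t m : ℕ} {ω : ℂ} (hω : IsPrimitiveRoot ω t) {b : Fin m → ℕ}
    (hb : b.Injective) (hbt : ∀ i, b i < t) :
    (powMatrix (fun i : Fin m => ω ^ (i : ℕ)) b).det ≠ 0 := by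
  have : powMatrix (fun i : Fin m => ω ^ (i : ℕ)) b = (vandermonde fun l : Fin m => ω ^ b l)ᵀ := by
    ext i j
    simp only [powMatrix_apply, transpose_apply, vandermonde_apply]
    rw [← pow_mul, ← pow_mul, mul_comm]
  rw [this, det_transpose, det_vandermonde_ne_zero_iff]
  exact fun l l' h => hb (hω.pow_inj (hbt l) (hbt l') h)

theorem schur_root_ne_zero {t m : ℕ} {ω : ℂ} (hω : IsPrimitiveRoot ω t) {ν : ℕ → ℕ}
    (hν : Antitone ν) (h0 : ∀ i, m ≤ i → ν i = 0) (hlt : ∀ i, i < m → beta m ν i < t) :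
    aeval (fun i : Fin m => ω ^ (i : ℕ)) (schur m ν) ≠ 0 := by
  have h1 := det_powMatrix_mul_schur (fun i : Fin m => ω ^ (i : ℕ)) h0
  have h2 := det_root_ne_zero hω (strictAnti_beta (N := m) hν).injective fun i => hlt i i.2
  rw [← h1] at h2
  exact right_ne_zero_of_mul h2

theorem det_twistedPoint_of_box {t n m : ℕ} (hn : 0 < n) (hm : m ≤ t) {ω : ℂ} (hω : ω ^ t = 1)
    {ν : ℕ → ℕ} (h0 : ∀ i, m ≤ i → ν i = 0) (hlt : ∀ i, i < m → beta m ν i < t) :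
    (powMatrix (twistedPoint t n m ω) fun k : Fin (t * n + m) => beta (t * n + m) ν k).det =
      (powMatrix (twistedPoint t n m ω) fun k : Fin (t * n + m) => t * n + m - 1 - k).det *
        (y ^ (∑ i ∈ Finset.range m, ν i) *
          C (aeval (fun i : Fin m => ω ^ (i : ℕ)) (schur m ν))) := by
  have hω' : (C ω : Poly n) ^ t = 1 := by rw [← map_pow, hω, map_one]
  obtain ⟨κ, hκ⟩ := exists_det_twisted_core (m := m) hn hω' x y
  -- The denominator is the case of the empty partition, hence carries the same `κ`.
  have hδ := beta_of_box (t := t) (n := n) (m := m) (ν := fun _ => 0) fun _ _ => rfl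
  simp only [beta, zero_add] at hδ
  have hC : ∀ b : Fin m → ℕ, (powMatrix (fun i : Fin m => (C ω : Poly n) ^ (i : ℕ)) b).det =
      C (powMatrix (fun i : Fin m => ω ^ (i : ℕ)) b).det := by
    intro b
    rw [map_det_powMatrix]
    congr 2
    funext i
    simp
  rw [twistedPoint_eq, beta_of_box h0, hδ, hκ _ fun i => hlt i i.2, hκ _ fun i => by omega, hC, hC,
    ← det_powMatrix_mul_schur _ h0, map_mul, Finset.sum_range]
  simp only [beta, Finset.sum_add_distrib, pow_add]
  ring

/-- The block of the columns whose exponents are congruent to `r`. -/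
theorem exists_block {t N d : ℕ} (ht : 0 < t) {lam : ℕ → ℕ} (hlam : Antitone lam) (r : Fin t)
    {σ : Type*} {f : Fin d → σ} (hf : f.Injective) (hd : residueCount t N lam r = d)
    (ρ : Fin N → Fin t) (hρ : ∀ k : Fin N, beta N (tCore t N lam) k % t = ρ k) (π : Equiv.Perm (Fin N))
    (h1 : ∀ k, beta N lam (π k) % t = ρ k) (h2 : ∀ i j, i < j → ρ i = ρ j → π i < π j) :
    ∃ ι : {k // ρ k = r} ≃ Fin d,
      (powMatrix ((fun i => (X (f i) : MvPolynomial σ ℂ)) ∘ ι)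
        fun k : {k // ρ k = r} => beta N (tCore t N lam) k).det ≠ 0 ∧
      (powMatrix ((fun i => (X (f i) : MvPolynomial σ ℂ)) ∘ ι)
        fun k : {k // ρ k = r} => beta N lam (π k)).det ≠ 0 ∧
      (powMatrix ((fun i => (X (f i) : MvPolynomial σ ℂ)) ∘ ι)
        fun k : {k // ρ k = r} => beta N lam (π k)).det =
      aeval (fun i => (X (f i) : MvPolynomial σ ℂ) ^ t) (schur d (tQuotient t N lam r)) *
        (powMatrix ((fun i => (X (f i) : MvPolynomial σ ℂ)) ∘ ι)
          fun k : {k // ρ k = r} => beta N (tCore t N lam) k).det := by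
  have hcard : Fintype.card {k // ρ k = r} = d := by
    rw [← hd, ← residueCount_tCore ht hlam r.2, ← card_residue_eq (antitone_tCore t N lam)]
    refine Fintype.card_congr (Equiv.subtypeEquivRight fun k => ?_)
    rw [hρ, Fin.ext_iff]
  let ι := Fintype.orderIsoFinOfCardEq _ hcard
  have hc : ∀ j, beta N (tCore t N lam) (ι j : Fin N) = t * (d - 1 - j) + r := by
    refine beta_tCore_fiber ht r.2 hlam (ι := fun j => (ι j : Fin N)) (fun i j hij => ι.strictMono hij) ?_
    intro i
    rw [hρ, ← Fin.ext_iff]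
    constructor
    · intro h
      exact ⟨ι.symm ⟨i, h⟩, by simp⟩
    · rintro ⟨j, rfl⟩
      exact (ι j).2
  have ha : ∀ j, beta N lam (π (ι j)) = t * beta d (tQuotient t N lam r) j + r := by
    refine beta_fiber hlam (ι := fun j => π (ι j))
      (fun i j hij => h2 _ _ (ι.strictMono hij) ((ι i).2.trans (ι j).2.symm)) ?_
    intro i
    obtain ⟨k, rfl⟩ := π.surjective i
    rw [h1, ← Fin.ext_iff]
    constructor
    · intro h
      exact ⟨ι.symm ⟨k, h⟩, by simp⟩
    · rintro ⟨j, hj⟩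
      rw [← π.injective hj]
      exact (ι j).2
  refine ⟨ι.symm.toEquiv, ?_, ?_, ?_⟩
  · refine (det_powMatrix_comp_equiv _ ι.toEquiv _).trans_ne (det_powMatrix_X_ne_zero hf ?_)
    exact (strictAnti_beta (antitone_tCore t N lam)).injective.comp
      (Subtype.val_injective.comp ι.injective)
  · refine (det_powMatrix_comp_equiv _ ι.toEquiv _).trans_ne (det_powMatrix_X_ne_zero hf ?_)
    exact (strictAnti_beta hlam).injective.comp
      (π.injective.comp (Subtype.val_injective.comp ι.injective))
  · refine (det_powMatrix_comp_equiv _ ι.toEquiv _).trans ?_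
    refine Eq.trans ?_ (congrArg _ (det_powMatrix_comp_equiv _ ι.toEquiv _).symm)
    have e1 : ((fun k : {k // ρ k = r} => beta N lam (π k)) ∘ ι.toEquiv) =
        fun j : Fin d => t * beta d (tQuotient t N lam r) j + r := funext ha
    have e2 : ((fun k : {k // ρ k = r} => beta N (tCore t N lam) k) ∘ ι.toEquiv) =
        fun j : Fin d => t * (d - 1 - j) + r := funext hc
    -- Both blocks carry the factor `∏ z_i^r`; what remains are alternants in the `z_i^t`, related
    -- by the bialternant formula.
    rw [e1, e2, det_powMatrix_mul_add, det_powMatrix_mul_add _ t r fun j : Fin d => d - 1 - j,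
      ← det_powMatrix_mul_schur _ fun i hi => tQuotient_eq_zero hd hi]
    ring

/-- The factor of the factorization that belongs to the residue `r`. -/
noncomputable def blockSchur (t n m : ℕ) (lam ν : ℕ → ℕ) (r : ℕ) : Poly n :=
  if r ∈ (Finset.range m).image (beta m ν) then
    aeval (powPointY t n) (schur (n + 1) (tQuotient t (t * n + m) lam r))
  else aeval (powPoint t n) (schur n (tQuotient t (t * n + m) lam r))

/-- The columns for `lam` are permuted by `π` so that they agree in residue with those of the core,
class by class in order; then the block comparison applies. -/
theorem det_twistedPoint_factor {t n m : ℕ} (ht : 0 < t) (hm : m ≤ t - 1)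
    {ω : ℂ} (hω : IsPrimitiveRoot ω t) {lam ν : ℕ → ℕ} (hlam : Antitone lam)
    (hν : ν = tCore t (t * n + m) lam) (h0 : ∀ i, m ≤ i → ν i = 0) (hν0 : ν 0 ≤ t - m)
    (E : List ℕ) :
    (powMatrix (twistedPoint t n m ω) fun k : Fin (t * n + m) => beta (t * n + m) lam k).det =
      ((Equiv.Perm.sign (sigma t (t * n + m) E lam) *
        Equiv.Perm.sign (sigma t (t * n + m) E ν) : ℤˣ) : ℤ) *
      (powMatrix (twistedPoint t n m ω) fun k : Fin (t * n + m) => beta (t * n + m) ν k).det *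
      ∏ r : Fin t, blockSchur t n m lam ν r ∧ ∀ r : Fin t, blockSchur t n m lam ν r ≠ 0 := by
  have hanti : Antitone ν := hν ▸ antitone_tCore t (t * n + m) lam
  have hlt : ∀ i, i < m → beta m ν i < t := fun i hi => beta_lt_of_box hm hanti hν0 hi
  obtain ⟨π, h1, h2⟩ := exists_perm_of_card_fiber
    (fun k : Fin (t * n + m) => (⟨beta (t * n + m) ν k % t, Nat.mod_lt _ ht⟩ : Fin t))
    (fun k : Fin (t * n + m) => (⟨beta (t * n + m) lam k % t, Nat.mod_lt _ ht⟩ : Fin t)) (by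
      intro r
      simp only [Fin.ext_iff]
      rw [card_residue_eq hanti, card_residue_eq hlam, hν, residueCount_tCore ht hlam r.2])
  set ρ : Fin (t * n + m) → Fin t := fun k => ⟨beta (t * n + m) ν k % t, Nat.mod_lt _ ht⟩ with hρ
  have h1' : ∀ k, beta (t * n + m) lam (π k) % t = ρ k := fun k => congrArg Fin.val (h1 k)
  let e : Fin m → Fin t := fun i => ⟨beta m ν i, hlt i i.2⟩
  have hrange : ∀ r : Fin t, r ∈ Set.range e ↔ (r : ℕ) ∈ (Finset.range m).image (beta m ν) := by
    intro r
    simp only [Set.mem_range, Finset.mem_image, Finset.mem_range, e, Fin.ext_iff]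
    exact ⟨fun ⟨i, h⟩ => ⟨i, i.2, h⟩, fun ⟨i, hi, h⟩ => ⟨⟨i, hi⟩, h⟩⟩
  have hcount : ∀ r : Fin t, residueCount t (t * n + m) lam r =
      if (r : ℕ) ∈ (Finset.range m).image (beta m ν) then n + 1 else n := by
    intro r
    rw [residueCount_of_box ht hm hlam (hν ▸ h0) (hν ▸ hν0) r.2, ← hν]
    simp only [Finset.mem_image, Finset.mem_range]
  have hblock : ∀ r : Fin t, ∃ w : {k // ρ k = r} → Poly n,
      (r ∈ Set.range e → ∃ ι : {k // ρ k = r} ≃ Fin (n + 1),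
        w = Fin.append x (fun _ : Fin 1 => y) ∘ ι) ∧
      (r ∉ Set.range e → ∃ ι : {k // ρ k = r} ≃ Fin n, w = x ∘ ι) ∧
      (powMatrix w fun k : {k // ρ k = r} => beta (t * n + m) ν k).det ≠ 0 ∧
      (powMatrix w fun k : {k // ρ k = r} => beta (t * n + m) lam (π k)).det ≠ 0 ∧
      (powMatrix w fun k : {k // ρ k = r} => beta (t * n + m) lam (π k)).det =
        blockSchur t n m lam ν r *
          (powMatrix w fun k : {k // ρ k = r} => beta (t * n + m) ν k).det := by
    intro r
    by_cases hr : r ∈ Set.range e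
    · have hr' := (hrange r).1 hr
      have hd := hcount r
      rw [if_pos hr'] at hd
      have hf : (Fin.append some (fun _ : Fin 1 => none) : Fin (n + 1) → Option (Fin n)).Injective := by
        intro i j
        refine Fin.addCases (fun i => ?_) (fun i => ?_) i <;>
        refine Fin.addCases (fun j => ?_) (fun j => ?_) j <;> simp
        exact Subsingleton.elim i j
      have hx : (fun i => (X ((Fin.append some (fun _ : Fin 1 => none) : Fin (n + 1) → Option (Fin n)) i) :
          Poly n)) = Fin.append x (fun _ : Fin 1 => y) := by
        funext i
        refine Fin.addCases (fun i => ?_) (fun i => ?_) i <;> simp [x, y]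
      have hxt : (fun i => (X ((Fin.append some (fun _ : Fin 1 => none) : Fin (n + 1) → Option (Fin n)) i) :
          Poly n) ^ t) = powPointY t n := by
        funext i
        refine Fin.addCases (fun i => ?_) (fun i => ?_) i <;> simp [x, y, powPointY, powPoint]
      obtain ⟨ι, h3, h4, h5⟩ := exists_block ht hlam r hf hd ρ (fun k => by rw [← hν]) π h1' h2
      rw [← hν, hx] at h3
      rw [hx] at h4
      rw [← hν, hx, hxt] at h5
      refine ⟨_, fun _ => ⟨ι, rfl⟩, fun h => absurd hr h, h3, h4, ?_⟩
      rw [blockSchur, if_pos hr', h5]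
    · have hr' := (hrange r).not.1 hr
      have hd := hcount r
      rw [if_neg hr'] at hd
      obtain ⟨ι, h3, h4, h5⟩ := exists_block ht hlam r (Option.some_injective (Fin n)) hd ρ
        (fun k => by rw [← hν]) π h1' h2
      rw [← hν] at h3 h5
      refine ⟨_, fun h => absurd h hr, fun _ => ⟨ι, rfl⟩, h3, h4, ?_⟩
      rw [blockSchur, if_neg hr']
      exact h5
  choose w hw1 hw2 hw3 hw4 hw5 using hblock
  refine ⟨?_, fun r hr => ?_⟩
  · have he : Function.Injective e := by
      intro i j hij
      exact (strictAnti_beta (N := m) hanti).injective (congrArg Fin.val hij)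
    have key := det_twisted_eq_mul_prod (hω.map_of_injective (C_injective (Option (Fin n)) ℂ))
      x y ρ (fun k => beta (t * n + m) lam (π k)) (fun k => beta (t * n + m) ν k) h1'
      (fun k => rfl) e he w hw1 hw2 hw3 (fun r => blockSchur t n m lam ν r) hw5
    rw [← twistedPoint_eq] at key
    have hperm := det_permute' π
      (powMatrix (twistedPoint t n m ω) fun k : Fin (t * n + m) => beta (t * n + m) lam k)
    have hsub : (powMatrix (twistedPoint t n m ω)
        fun k : Fin (t * n + m) => beta (t * n + m) lam k).submatrix id π =
        powMatrix (twistedPoint t n m ω) fun k => beta (t * n + m) lam (π k) := rfl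
    rw [hsub, key] at hperm
    rw [← sign_eq_sign_sigma ht π (fun k => h1' k) fun i j hij h => h2 i j hij (Fin.ext h),
      mul_assoc, hperm, ← mul_assoc, ← Int.cast_mul, Int.units_coe_mul_self, Int.cast_one, one_mul]
  -- If the factor vanished, so would the block of `lam`, an alternant in distinct indeterminates
  -- with distinct exponents.
  · refine hw4 r ?_
    rw [hw5, hr, zero_mul]

theorem prod_blockSchur {t n m : ℕ} {lam ν : ℕ → ℕ} (hν : Antitone ν)
    (hlt : ∀ i, i < m → beta m ν i < t) :
    ∏ r : Fin t, blockSchur t n m lam ν r =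
      (∏ i ∈ Finset.range m,
        aeval (powPointY t n) (schur (n + 1) (tQuotient t (t * n + m) lam (beta m ν i)))) *
      ∏ j ∈ Finset.range t \ (Finset.range m).image (beta m ν),
        aeval (powPoint t n) (schur n (tQuotient t (t * n + m) lam j)) := by
  have hsub : (Finset.range m).image (beta m ν) ⊆ Finset.range t := by
    intro r hr
    obtain ⟨i, hi, rfl⟩ := Finset.mem_image.1 hr
    exact Finset.mem_range.2 (hlt i (Finset.mem_range.1 hi))
  rw [← Finset.prod_range, ← Finset.prod_sdiff hsub, mul_comm]
  congr 1
  · rw [Finset.prod_image]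
    · exact Finset.prod_congr rfl fun i hi => if_pos (Finset.mem_image_of_mem _ hi)
    · intro i hi j hj hij
      have := (strictAnti_beta (N := m) hν).injective (a₁ := ⟨i, by simpa using hi⟩)
        (a₂ := ⟨j, by simpa using hj⟩) hij
      exact congrArg Fin.val this
  · exact Finset.prod_congr rfl fun j hj => if_neg (Finset.mem_sdiff.1 hj).2

end SchurFactorization

/-! ### The factorization theorem. -/

open SchurFactorization in
theorem mainTheorem1 (t n m : ℕ) (ht : 2 ≤ t) (hn : 1 ≤ n) (hm : m ≤ t - 1)
    (ω : ℂ) (hω : IsPrimitiveRoot ω t)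
    (lam : ℕ → ℕ) (hlam : Antitone lam) (hlen : ∀ i, t * n + m ≤ i → lam i = 0)
    (ν : ℕ → ℕ) (hν : ν = tCore t (t * n + m) lam) :
    (MvPolynomial.aeval (twistedPoint t n m ω) (schur (t * n + m) lam) ≠ 0 ↔
      (∀ i, m ≤ i → ν i = 0) ∧ ν 0 ≤ t - m) ∧
    ((∀ i, m ≤ i → ν i = 0) ∧ ν 0 ≤ t - m →
      MvPolynomial.aeval (twistedPoint t n m ω) (schur (t * n + m) lam) =
        (((Equiv.Perm.sign (sigma t (t * n + m) ((List.range m).map (beta m ν)) lam) *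
            Equiv.Perm.sign (sigma t (t * n + m) ((List.range m).map (beta m ν)) ν) : ℤˣ) : ℤ) :
            Poly n) *
          y ^ (∑ i ∈ Finset.range m, ν i) *
          MvPolynomial.C
            (MvPolynomial.aeval (fun i : Fin m => ω ^ (i : ℕ)) (schur m ν)) *
          (∏ i ∈ Finset.range m,
            MvPolynomial.aeval (powPointY t n)
              (schur (n + 1) (tQuotient t (t * n + m) lam (beta m ν i)))) *
          (∏ j ∈ Finset.range t \ (Finset.range m).image (beta m ν),
            MvPolynomial.aeval (powPoint t n)
              (schur n (tQuotient t (t * n + m) lam j)))) := by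
  have ht0 : 0 < t := by omega
  have hδ := det_twistedPoint_ne_zero (n := n) (m := m) (by omega) hω ht0
  have hS := det_powMatrix_mul_schur (twistedPoint t n m ω) hlen
  have hanti : Antitone ν := hν ▸ antitone_tCore t (t * n + m) lam
  have formula : (∀ i, m ≤ i → ν i = 0) ∧ ν 0 ≤ t - m → ∀ E : List ℕ,
      MvPolynomial.aeval (twistedPoint t n m ω) (schur (t * n + m) lam) =
        (((Equiv.Perm.sign (sigma t (t * n + m) E lam) *
            Equiv.Perm.sign (sigma t (t * n + m) E ν) : ℤˣ) : ℤ) : Poly n) *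
          y ^ (∑ i ∈ Finset.range m, ν i) *
          MvPolynomial.C
            (MvPolynomial.aeval (fun i : Fin m => ω ^ (i : ℕ)) (schur m ν)) *
          ∏ r : Fin t, blockSchur t n m lam ν r := by
    rintro ⟨h0, h1⟩ E
    have hlt : ∀ i, i < m → beta m ν i < t := fun i hi => beta_lt_of_box hm hanti h1 hi
    refine mul_left_cancel₀ hδ ?_
    rw [hS, (det_twistedPoint_factor ht0 hm hω hlam hν h0 h1 E).1,
      det_twistedPoint_of_box hn (by omega) hω.pow_eq_one h0 hlt]
    ring
  refine ⟨⟨fun hne => ?_, fun hbox => ?_⟩, fun hbox => ?_⟩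
  · have hdet : ∀ r, r < t → ¬ (residueCount t (t * n + m) lam r < n ∨
        n + 1 < residueCount t (t * n + m) lam r) := by
      intro r hr hcount
      rw [← card_residue_eq hlam] at hcount
      have hz := det_twisted_eq_zero (R := Poly n) (ω := MvPolynomial.C ω)
        (by rw [← map_pow, hω.pow_eq_one, map_one]) x y
        (fun k : Fin (t * n + m) => beta (t * n + m) lam k) ⟨r, hr⟩ hcount
      rw [← twistedPoint_eq, ← hS] at hz
      exact (mul_ne_zero hδ hne) hz
    rw [hν]
    refine box_of_residueCount ht0 hn hlam (fun r hr => ?_) fun r hr => ?_ <;>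
    · have := hdet r hr
      omega
  · have hlt : ∀ i, i < m → beta m ν i < t := fun i hi => beta_lt_of_box hm hanti hbox.2 hi
    -- The formula holds for any order of residues, and nonvanishing does not depend on it.
    rw [formula hbox []]
    have hf := (det_twistedPoint_factor ht0 hm hω hlam hν hbox.1 hbox.2 []).2
    refine mul_ne_zero (mul_ne_zero (mul_ne_zero ?_ (pow_ne_zero _ (MvPolynomial.X_ne_zero _))) ?_)
      (Finset.prod_ne_zero_iff.2 fun r _ => hf r)
    · exact Int.cast_ne_zero.2 (Units.ne_zero _)
    · rw [Ne, MvPolynomial.C_eq_zero]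
      exact schur_root_ne_zero hω hanti hbox.1 hlt
  · have hlt : ∀ i, i < m → beta m ν i < t := fun i hi => beta_lt_of_box hm hanti hbox.2 hi
    rw [formula hbox, prod_blockSchur hanti hlt]
    ring
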